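/- Let $(X_t)$ be a birth-and-death chain on $\Omega=\{0,\dots,n\}$: a discrete-time Markov chain whose transition matrix $P$ satisfies $P(x,y)=0$ whenever $|x-y|>1$. Suppose it is irreducible and lazy, i.e. $P(x,x)\ge \frac12$ for all $x$, and let $\pi$ be its stationary distribution. Write $d(t)=\max_{x\in\Omega}\frac12\sum_{y}|P^t(x,y)-\pi(y)|$ and $t_{\mathrm{mix}}(\delta)=\min\{t\in\mathbb{N}: d(t)\le\delta\}$ for $0<\delta<1$; let $t_{\mathrm{rel}}=1/(1-\lambda)$, where $\lambda$ is the largest absolute value of an eigenvalue of $P$ other than $1$ ($\lambda=0$ if $n=0$); let $Q(\delta)=\min\{k:\sum_{j=0}^{k}\pi(j)\ge\delta\}$; and let $\mathbb{E}_x\tau_y$ be the expected value of the hitting time $\tau_y=\min\{t\ge 0:X_t=y\}$ for the chain started at $x$. Suppose that $t_{\mathrm{rel}}<\epsilon^5\cdot t_{\mathrm{mix}}(\frac14)$ for some $0<\epsilon<\frac1{16}$. Then $$t_{\mathrm{mix}}(4\epsilon)-t_{\mathrm{mix}}(1-2\epsilon)\le \frac{6}{\epsilon}\sqrt{t_{\mathrm{rel}}\cdot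 t_{\mathrm{mix}}(\tfrac14)}.$$ Moreover, the cutoff is located as follows. If $\mathbb{E}_0\tau_{Q(1-\epsilon)}\ge\mathbb{E}_n\tau_{Q(\epsilon)}$, then $h=\mathbb{E}_0\tau_{Q(1/2)}$ is finite and $$t_{\mathrm{mix}}(1-2\epsilon)\ge h-\frac{2}{\epsilon}\sqrt{t_{\mathrm{rel}}\cdot h},\qquad t_{\mathrm{mix}}(4\epsilon)\le h+\frac{3}{\epsilon}\sqrt{t_{\mathrm{rel}}\cdot h}.$$ If $\mathbb{E}_0\tau_{Q(1-\epsilon)}\le\mathbb{E}_n\tau_{Q(\epsilon)}$, the same holds with $h=\mathbb{E}_n\tau_{Q(1/2)}$. -/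

import Mathlib

open MeasureTheory ProbabilityTheory
open scoped ENNReal

noncomputable section

/-- A discrete-time birth-and-death chain on the state space `{0, …, n}`: a stochastic transition
matrix all of whose transitions go to an adjacent state or stay in place. -/
structure BirthDeathChain (n : ℕ) where
  /-- the transition matrix -/
  P : Matrix (Fin (n + 1)) (Fin (n + 1)) ℝ
  stochastic : P ∈ Matrix.rowStochastic ℝ (Fin (n + 1))
  adjacent : ∀ x y : Fin (n + 1), P x y ≠ 0 → |(x : ℤ) - (y : ℤ)| ≤ 1

/-- Total-variation distance of two distributions (given by their weights) on a finite space. -/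
def tvDist {Ω : Type*} [Fintype Ω] (μ ν : Ω → ℝ) : ℝ :=
  (1 / 2) * ∑ x, |μ x - ν x|

namespace BirthDeathChain

variable {n : ℕ} (X : BirthDeathChain n)

def IsLazy : Prop := ∀ x, 1 / 2 ≤ X.P x x

def IsIrreducible : Prop := X.P.IsIrreducible

/-- `π` is a stationary (probability) distribution of the chain. -/
structure IsStationary (π : Fin (n + 1) → ℝ) : Prop where
  nonneg : ∀ x, 0 ≤ π x
  sum_eq_one : ∑ x, π x = 1
  invariant : Matrix.vecMul π X.P = π

/-- The worst-case distance `d(t) = max_x ‖P^t(x, ·) - π‖_TV` (a maximum over a finite set). -/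
def worstDist (π : Fin (n + 1) → ℝ) (t : ℕ) : ℝ :=
  ⨆ x, tvDist ((X.P ^ t) x) π

/-- The mixing time `t_mix(ε) = min {t : d(t) ≤ ε}`. -/
def tmix (π : Fin (n + 1) → ℝ) (ε : ℝ) : ℕ :=
  sInf {t : ℕ | X.worstDist π t ≤ ε}

/-- The largest absolute value of the eigenvalues of `P` other than `1`. An irreducible
birth-and-death chain is reversible, so all its eigenvalues are real and `1` is simple. On a
one-point space there is no nontrivial eigenvalue and the value is `0`. -/
def lambdaStar : ℝ :=
  sSup {r : ℝ | ∃ μ : ℝ, Module.End.HasEigenvalue (Matrix.toLin' X.P) μ ∧ μ ≠ 1 ∧ r = |μ|}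

/-- The spectral gap. -/
def gap : ℝ := 1 - X.lambdaStar

/-- The relaxation time. -/
def trel : ℝ := X.gap⁻¹

/-- One step of the chain, as a Markov kernel: `P(x, ·) = ∑ y, P(x, y) δ_y`. -/
def stepKernel : Kernel (Fin (n + 1)) (Fin (n + 1)) where
  toFun x := ∑ y, ENNReal.ofReal (X.P x y) • Measure.dirac y
  measurable' := measurable_from_top

instance : IsMarkovKernel X.stepKernel where
  isProbabilityMeasure x := ⟨by
    have h := X.stochastic
    have h2 : ∑ y, X.P x y = 1 := by
      simpa [Matrix.mulVec, dotProduct] using congrFun h.2 x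
    change (∑ y, ENNReal.ofReal (X.P x y) • Measure.dirac y : Measure (Fin (n + 1))) Set.univ = 1
    simp only [Measure.coe_finsetSum, Finset.sum_apply, Measure.smul_apply, measure_univ,
      smul_eq_mul, mul_one]
    rw [← ENNReal.ofReal_sum_of_nonneg (fun y _ => h.1 x y), h2, ENNReal.ofReal_one]⟩

/-- The conditional law of `X_{t+1}` given the history `(X_0, …, X_t)`: the Markov property says
that it is `P(X_t, ·)`. -/
def historyKernel (t : ℕ) : Kernel ((_ : Finset.Iic t) → Fin (n + 1)) (Fin (n + 1)) :=
  X.stepKernel.comap (fun h => h ⟨t, Finset.mem_Iic.2 le_rfl⟩) (measurable_pi_apply _)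

instance (t : ℕ) : IsMarkovKernel (X.historyKernel t) := by
  unfold historyKernel
  infer_instance

/-- `ℙ_x`: the law on the space of trajectories `ℕ → {0, …, n}` of the chain started from
`X_0 = x`, given by the Ionescu-Tulcea theorem. -/
def pathLaw (x : Fin (n + 1)) : Measure (ℕ → Fin (n + 1)) :=
  Kernel.traj (X := fun _ => Fin (n + 1)) X.historyKernel 0 (fun _ => x)

/-- The hitting time `τ_y = min {t : X_t = y}` of a trajectory (`∞` if `y` is never visited). -/
def hitTime (y : Fin (n + 1)) (ω : ℕ → Fin (n + 1)) : ℝ≥0∞ :=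
  ⨅ (t : ℕ) (_ : ω t = y), (t : ℝ≥0∞)

/-- The expected hitting time `𝔼_x τ_y`, with values in `[0, ∞]`. -/
def expHit (x y : Fin (n + 1)) : ℝ≥0∞ :=
  ∫⁻ ω, hitTime y ω ∂(X.pathLaw x)

end BirthDeathChain

/-- The quantile state `Q(ε) = min {k : π(0) + ⋯ + π(k) ≥ ε}`. -/
def quantile {n : ℕ} (π : Fin (n + 1) → ℝ) (ε : ℝ) : Fin (n + 1) :=
  (Finset.univ.filter fun k : Fin (n + 1) => ε ≤ ∑ j ∈ Finset.Iic k, π j).inf id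

/-- For `ε ≤ 1` the minimum that defines the quantile state is attained. -/
theorem isLeast_quantile {n : ℕ} {π : Fin (n + 1) → ℝ} (h : ∑ j, π j = 1) {ε : ℝ} (hε : ε ≤ 1) :
    IsLeast {k : Fin (n + 1) | ε ≤ ∑ j ∈ Finset.Iic k, π j} (quantile π ε) := by
  have hne : (Finset.univ.filter fun k : Fin (n + 1) => ε ≤ ∑ j ∈ Finset.Iic k, π j).Nonempty := by
    refine ⟨Fin.last n, Finset.mem_filter.2 ⟨Finset.mem_univ _, ?_⟩⟩
    have : Finset.Iic (Fin.last n) = Finset.univ := by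
      ext j
      simp [Fin.le_last]
    rw [this, h]
    exact hε
  have hq : quantile π ε
      = (Finset.univ.filter fun k : Fin (n + 1) => ε ≤ ∑ j ∈ Finset.Iic k, π j).min' hne := by
    rw [Finset.min'_eq_inf', Finset.inf'_eq_inf hne]
    rfl
  rw [hq]
  refine ⟨?_, fun k hk => Finset.min'_le _ _ ?_⟩
  · exact (Finset.mem_filter.1 (Finset.min'_mem _ hne)).2
  · exact Finset.mem_filter.2 ⟨Finset.mem_univ _, hk⟩

end

/-!
The proof compares the worst-case distance to stationarity with the hitting times of the quantile
states `a = Q(ε)` and `b = Q(1 - ε)` from the two ends of the state space, and shows that these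
hitting times are concentrated around their means.

*Concentration.* The chain started at `0` and killed at `b` has Green kernel
`G(x, y) = π(y) R(max x y)`, where `R(k)` is the effective resistance between `k` and `b`. This
gives the mean `𝔼_0 τ_b = tr G` and, since every state below `b` is visited, the trace formula
`Var_0 τ_b = tr G² - tr G` (`IsStationary.varHit_zero`). The Poincaré inequality
(`IsStationary.poincare`), applied to the columns of `G`, which vanish on `{b, …, n}`, bounds `tr G²` by
`t_rel / π([b, n]) · tr G`; hence the variance of `τ_b` is at most `(t_rel / ε) 𝔼_0 τ_b`
(`IsStationary.varHit_le`). The Poincaré inequality for the function `x ↦ 𝔼_{max x a} τ_b` shows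
that the bulk of the stationary distribution is crossed quickly: `𝔼_a τ_b ≤ 2 t_rel / ε`
(`IsStationary.mul_meanHit_le_trel`).

*Comparison.* Two lazy walkers that move one at a time meet before they cross. So a walker that has
swept from one end past the bulk has met a stationary walker, up to probability `ε`, and
`d(t) ≤ 2 ε + ℙ_0(τ_b > t) + ℙ_n(τ_a > t)` (`IsStationary.worstDist_le_surv`). Conversely a walker
from `0` that has not reached `a` sees only mass `ε`, so `d(t) ≥ ℙ_0(τ_a > t) - ε`
(`IsStationary.surv_le_worstDist`).

Chebyshev's inequality for the hitting times then locates the cutoff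
(`IsStationary.cutoff_location`). All hitting probabilities are handled through the first-step
recursion `surv`, which `expHit_eq_tsum` identifies with the law of the trajectories, and tail
bounds are proved by induction on time. The case where the sweep from `n` is the slower one follows
by reflecting the state space.
-/

noncomputable section

/-! ### Survival probabilities and the law of trajectories -/

namespace BirthDeathChain

variable {n : ℕ} (X : BirthDeathChain n)

theorem P_nonneg (x y : Fin (n + 1)) : 0 ≤ X.P x y := X.stochastic.1 x y

theorem sum_P (x : Fin (n + 1)) : ∑ y, X.P x y = 1 :=
  Matrix.sum_row_of_mem_rowStochastic X.stochastic x

/-- The survival probability `ℙ_x(τ_y > t)`, given by first-step analysis. -/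
def surv (y : Fin (n + 1)) : ℕ → Fin (n + 1) → ℝ
  | 0, x => if x = y then 0 else 1
  | t + 1, x => if x = y then 0 else ∑ z, X.P x z * surv y t z

theorem surv_self (y : Fin (n + 1)) (t : ℕ) : X.surv y t y = 0 := by
  cases t <;> simp [surv]

theorem surv_zero {x y : Fin (n + 1)} (h : x ≠ y) : X.surv y 0 x = 1 := by
  simp [surv, h]

theorem surv_succ {x y : Fin (n + 1)} (h : x ≠ y) (t : ℕ) :
    X.surv y (t + 1) x = ∑ z, X.P x z * X.surv y t z := by
  simp [surv, h]

theorem surv_nonneg (y : Fin (n + 1)) (t : ℕ) (x : Fin (n + 1)) : 0 ≤ X.surv y t x := by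
  induction t generalizing x with
  | zero => unfold surv; split_ifs <;> norm_num
  | succ t ih =>
    unfold surv
    split_ifs
    · exact le_rfl
    · exact Finset.sum_nonneg fun z _ => mul_nonneg (X.P_nonneg x z) (ih z)

theorem lintegral_stepKernel (f : Fin (n + 1) → ℝ≥0∞) (x : Fin (n + 1)) :
    ∫⁻ z, f z ∂(X.stepKernel x) = ∑ z, ENNReal.ofReal (X.P x z) * f z := by
  change ∫⁻ z, f z ∂(∑ y, ENNReal.ofReal (X.P x y) • Measure.dirac y) = _
  simp [lintegral_finsetSum_measure]

/-- The Markov property at time `t`. -/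
theorem lintegral_pathLaw_step (x : Fin (n + 1)) (t : ℕ)
    (F : ((_ : Finset.Iic t) → Fin (n + 1)) → ℝ≥0∞) (G : Fin (n + 1) → ℝ≥0∞) :
    ∫⁻ ω, F (Preorder.frestrictLe t ω) * G (ω (t + 1)) ∂(X.pathLaw x)
      = ∫⁻ ω, F (Preorder.frestrictLe t ω) * ∑ z, ENNReal.ofReal (X.P (ω t) z) * G z
          ∂(X.pathLaw x) := by
  have key : ∀ (s : ℕ) (g : ((_ : Finset.Iic s) → Fin (n + 1)) → ℝ≥0∞),
      ∫⁻ ω, g (Preorder.frestrictLe s ω) ∂(X.pathLaw x)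
        = ∫⁻ h, g h ∂(Kernel.partialTraj (X := fun _ => Fin (n + 1)) X.historyKernel 0 s
            (fun _ => x)) := by
    intro s g
    rw [← Kernel.traj_map_frestrictLe_apply,
      lintegral_map Measurable.of_discrete (Preorder.measurable_frestrictLe s)]
    rfl
  have h1 := key (t + 1) (fun h => F (Preorder.frestrictLe₂ (π := fun _ => Fin (n + 1)) t.le_succ h)
    * G (h ⟨t + 1, Finset.mem_Iic.2 le_rfl⟩))
  have h2 := key t (fun h => F h * ∑ z, ENNReal.ofReal (X.P (h ⟨t, Finset.mem_Iic.2 le_rfl⟩) z)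
    * G z)
  refine h1.trans (Eq.trans ?_ h2.symm)
  rw [Kernel.partialTraj_succ_of_le (Nat.zero_le t), Kernel.lintegral_map _ (by fun_prop) _
    Measurable.of_discrete, Kernel.lintegral_comp _ _ _ Measurable.of_discrete]
  refine lintegral_congr fun h => ?_
  rw [Kernel.lintegral_id_prod Measurable.of_discrete,
    Kernel.lintegral_map _ (by fun_prop) _ Measurable.of_discrete]
  refine Eq.trans (lintegral_congr fun z => ?_) (lintegral_const_mul (F h) Measurable.of_discrete
    |>.trans (congrArg (F h * ·) (X.lintegral_stepKernel G _)))
  congr 2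
  · ext i
    simp [IicProdIoc, Finset.mem_Iic.1 i.2]
  · simp [IicProdIoc, MeasurableEquiv.piSingleton]

/-- The Markov property at time `t` for the survival probabilities:
`𝔼_x[ℙ_{X_t}(τ_y > s); τ_y > t] = ℙ_x(τ_y > t + s)`. -/
theorem lintegral_pathLaw_killed (x y : Fin (n + 1)) (t s : ℕ) :
    ∫⁻ ω, (if ∀ r ≤ t, ω r ≠ y then ENNReal.ofReal (X.surv y s (ω t)) else 0) ∂(X.pathLaw x)
      = ENNReal.ofReal (X.surv y (t + s) x) := by
  induction t generalizing s with
  | zero =>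
    let f : (ℕ → Fin (n + 1)) → ℝ≥0∞ := fun ω =>
      if ω 0 ≠ y then ENNReal.ofReal (X.surv y s (ω 0)) else 0
    have hf : Measurable f := by
      have : Measurable fun z : Fin (n + 1) =>
        (if z ≠ y then ENNReal.ofReal (X.surv y s z) else 0) := Measurable.of_discrete
      exact this.comp (measurable_pi_apply (0 : ℕ))
    have h := Kernel.lintegral_traj (X := fun _ => Fin (n + 1)) (κ := X.historyKernel) (a := 0)
      (fun _ => x) hf
    simp only [Nat.le_zero, forall_eq]
    refine h.trans ?_
    have : IsProbabilityMeasure (Kernel.traj (X := fun _ => Fin (n + 1)) X.historyKernel 0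
        (fun _ => x)) := inferInstance
    by_cases hxy : x = y
    · subst hxy
      simp [f, Function.updateFinset, surv_self]
    · simp [f, Function.updateFinset, hxy]
  | succ t ih =>
    rw [show t + 1 + s = t + (s + 1) by ring, ← ih (s + 1)]
    have h := X.lintegral_pathLaw_step x t
      (fun h => if ∀ r : Finset.Iic t, h r ≠ y then 1 else 0)
      (fun z => if z ≠ y then ENNReal.ofReal (X.surv y s z) else 0)
    refine Eq.trans (lintegral_congr fun ω => ?_) (h.trans (lintegral_congr fun ω => ?_))
    · by_cases h1 : ∀ r ≤ t, ω r ≠ y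
      · have h2 : ∀ r : Finset.Iic t, Preorder.frestrictLe t ω r ≠ y :=
          fun r => h1 r (Finset.mem_Iic.1 r.2)
        by_cases h3 : ω (t + 1) = y
        · rw [if_neg (fun h4 => h4 (t + 1) le_rfl h3), if_pos h2, if_neg (not_not.2 h3), mul_zero]
        · rw [if_pos, if_pos h2, if_pos h3, one_mul]
          intro r hr
          rcases Nat.lt_or_eq_of_le hr with h4 | rfl
          · exact h1 r (Nat.lt_succ_iff.1 h4)
          · exact h3
      · rw [if_neg (fun h2 => h1 fun r hr => h2 r (hr.trans t.le_succ)), if_neg, zero_mul]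
        exact fun h2 => h1 fun r hr => h2 ⟨r, Finset.mem_Iic.2 hr⟩
    · by_cases h1 : ∀ r ≤ t, ω r ≠ y
      · have h2 : ∀ r : Finset.Iic t, Preorder.frestrictLe t ω r ≠ y :=
          fun r => h1 r (Finset.mem_Iic.1 r.2)
        rw [if_pos h1, if_pos h2, one_mul, X.surv_succ (h1 t le_rfl),
          ENNReal.ofReal_sum_of_nonneg fun z _ => mul_nonneg (X.P_nonneg _ z) (X.surv_nonneg y s z)]
        refine Finset.sum_congr rfl fun z _ => ?_
        rw [ENNReal.ofReal_mul (X.P_nonneg _ z)]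
        by_cases h3 : z = y
        · subst h3
          simp [surv_self]
        · rw [if_pos h3]
      · rw [if_neg h1, if_neg, zero_mul]
        exact fun h2 => h1 fun r hr => h2 ⟨r, Finset.mem_Iic.2 hr⟩

/-- A hitting time is the number of times at which the state has not been visited yet. -/
theorem hitTime_eq_tsum (y : Fin (n + 1)) (ω : ℕ → Fin (n + 1)) :
    hitTime y ω = ∑' t : ℕ, if ∀ r ≤ t, ω r ≠ y then 1 else 0 := by
  unfold hitTime
  by_cases h : ∃ t, ω t = y
  · have hN := Nat.find_spec h
    have hmin : ∀ r, r < Nat.find h → ω r ≠ y := fun r hr => Nat.find_min h hr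
    generalize Nat.find h = N at hN hmin
    have h1 : ⨅ (t : ℕ) (_ : ω t = y), (t : ℝ≥0∞) = N := by
      refine le_antisymm (iInf₂_le N hN) (le_iInf₂ fun t ht => ?_)
      exact_mod_cast not_lt.1 fun hlt => hmin t hlt ht
    rw [h1, tsum_eq_sum (s := Finset.range N)]
    · rw [Finset.sum_congr rfl (g := fun _ => 1)]
      · simp
      · intro t ht
        rw [if_pos]
        exact fun r hr => hmin r (hr.trans_lt (Finset.mem_range.1 ht))
    · intro t ht
      rw [if_neg]
      exact fun h2 => h2 N (not_lt.1 fun hlt => ht (Finset.mem_range.2 hlt)) hN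
  · push Not at h
    simp [h]

theorem expHit_eq_tsum (x y : Fin (n + 1)) :
    X.expHit x y = ∑' t : ℕ, ENNReal.ofReal (X.surv y t x) := by
  unfold expHit
  simp only [hitTime_eq_tsum]
  have hmeas : ∀ t : ℕ, MeasurableSet {ω : ℕ → Fin (n + 1) | ∀ r ≤ t, ω r ≠ y} := by
    intro t
    have : {ω : ℕ → Fin (n + 1) | ∀ r ≤ t, ω r ≠ y}
        = ⋂ r, ⋂ (_ : r ≤ t), (fun ω : ℕ → Fin (n + 1) => ω r) ⁻¹' {y}ᶜ := by
      ext ω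
      simp
    rw [this]
    exact MeasurableSet.iInter fun r => MeasurableSet.iInter fun _ =>
      measurable_pi_apply r (MeasurableSet.of_discrete)
  rw [lintegral_tsum fun t => (Measurable.ite (hmeas t) measurable_const
    measurable_const).aemeasurable]
  refine tsum_congr fun t => ?_
  rw [← add_zero t, ← X.lintegral_pathLaw_killed x y t 0]
  refine lintegral_congr fun ω => ?_
  by_cases h : ∀ r ≤ t, ω r ≠ y
  · rw [add_zero, if_pos h, if_pos h, X.surv_zero (h t le_rfl), ENNReal.ofReal_one]
  · rw [add_zero, if_neg h, if_neg h]

end BirthDeathChain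

/-! ### Reversibility and the spectral gap inequality -/

namespace BirthDeathChain

variable {n : ℕ} (X : BirthDeathChain n)

/-- The rate of the step `k → k + 1`, with value `0` if this step leaves the state space. -/
def up (k : ℕ) : ℝ := if h : k + 1 < n + 1 then X.P ⟨k, by lia⟩ ⟨k + 1, h⟩ else 0

/-- The rate of the step `k → k - 1`, with value `0` at `k = 0` and outside the state space. -/
def dn (k : ℕ) : ℝ := if h : 0 < k ∧ k < n + 1 then X.P ⟨k, h.2⟩ ⟨k - 1, by lia⟩ else 0

theorem P_eq_zero {x y : Fin (n + 1)} (h : (x : ℕ) + 1 < y ∨ (y : ℕ) + 1 < x) : X.P x y = 0 := by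
  by_contra hne
  have := abs_le.1 (X.adjacent x y hne)
  lia

theorem up_nonneg (k : ℕ) : 0 ≤ X.up k := by
  unfold up
  split_ifs
  · exact X.P_nonneg _ _
  · exact le_rfl

theorem dn_nonneg (k : ℕ) : 0 ≤ X.dn k := by
  unfold dn
  split_ifs
  · exact X.P_nonneg _ _
  · exact le_rfl

/-- One step of the chain, written through the two nearest-neighbour increments. -/
theorem sum_P_mul (f : ℕ → ℝ) (x : Fin (n + 1)) :
    ∑ y, X.P x y * f y
      = f x + X.up x * (f (x + 1) - f x) + X.dn x * (f (x - 1) - f x) := by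
  have h1 : ∑ y, X.P x y * f y = f x + ∑ y, X.P x y * (f y - f x) := by
    simp only [mul_sub, Finset.sum_sub_distrib, ← Finset.sum_mul, X.sum_P, one_mul]
    ring
  have h2 : ∀ y : Fin (n + 1), X.P x y * (f y - f x)
      = (if (y : ℕ) = x + 1 then X.P x y * (f y - f x) else 0)
        + (if (y : ℕ) + 1 = x then X.P x y * (f y - f x) else 0) := by
    intro y
    split_ifs with ha hb hb
    · lia
    · ring
    · ring
    · by_cases hxy : y = x
      · subst hxy
        ring
      · have : (y : ℕ) ≠ x := fun h => hxy (Fin.ext h)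
        rw [X.P_eq_zero (by lia)]
        ring
  have h3 : ∑ y : Fin (n + 1), (if (y : ℕ) = x + 1 then X.P x y * (f y - f x) else 0)
      = X.up x * (f (x + 1) - f x) := by
    unfold up
    split_ifs with h
    · rw [Finset.sum_eq_single (⟨x + 1, h⟩ : Fin (n + 1))]
      · simp
      · intro y _ hy
        rw [if_neg fun h' => hy (Fin.ext h')]
      · simp
    · rw [zero_mul]
      refine Finset.sum_eq_zero fun y _ => if_neg ?_
      lia
  have h4 : ∑ y : Fin (n + 1), (if (y : ℕ) + 1 = x then X.P x y * (f y - f x) else 0)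
      = X.dn x * (f (x - 1) - f x) := by
    unfold dn
    split_ifs with h
    · rw [Finset.sum_eq_single (⟨x - 1, by lia⟩ : Fin (n + 1))]
      · rw [if_pos (by simp; lia)]
      · intro y _ hy
        rw [if_neg fun h' => hy (Fin.ext (by simp; lia))]
      · simp
    · rw [zero_mul]
      refine Finset.sum_eq_zero fun y _ => if_neg ?_
      lia
  rw [h1, Finset.sum_congr rfl fun y _ => h2 y, Finset.sum_add_distrib, h3, h4]
  ring

theorem up_pos (hirr : X.IsIrreducible) {k : ℕ} (hk : k < n) : 0 < X.up k := by
  refine lt_of_le_of_ne (X.up_nonneg k) fun h0 => ?_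
  -- if the step `k → k + 1` were impossible, then `{0, …, k}` would be closed
  have hclosed : ∀ m : ℕ, ∀ x y : Fin (n + 1), (x : ℕ) ≤ k → k < (y : ℕ) → (X.P ^ m) x y = 0 := by
    intro m
    induction m with
    | zero =>
      intro x y hx hy
      rw [pow_zero, Matrix.one_apply_ne]
      rintro rfl
      lia
    | succ m ih =>
      intro x y hx hy
      rw [pow_succ', Matrix.mul_apply]
      refine Finset.sum_eq_zero fun z _ => ?_
      by_cases hz : (z : ℕ) ≤ k
      · rw [ih z y hz hy, mul_zero]
      · by_cases hx1 : (x : ℕ) + 1 < z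
        · rw [X.P_eq_zero (Or.inl hx1), zero_mul]
        · have hxk : x = ⟨k, by lia⟩ := Fin.ext (by simp; lia)
          have hzk : z = ⟨k + 1, by lia⟩ := Fin.ext (by simp; lia)
          have : X.P x z = 0 := by
            rw [h0, up, dif_pos (by lia)]
            exact congrArg₂ X.P hxk hzk
          rw [this, zero_mul]
  obtain ⟨m, -, hm⟩ := (Matrix.isIrreducible_iff_exists_pow_pos X.P_nonneg).1 hirr
    ⟨k, by lia⟩ ⟨k + 1, by lia⟩
  rw [hclosed m _ _ le_rfl (Nat.lt_succ_self k)] at hm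
  exact hm.false

namespace IsStationary

variable {X} {π : Fin (n + 1) → ℝ}

theorem sum_mul_P (hπ : X.IsStationary π) (y : Fin (n + 1)) : ∑ x, π x * X.P x y = π y :=
  congrFun hπ.invariant y

theorem sum_mul_pow (hπ : X.IsStationary π) (t : ℕ) (y : Fin (n + 1)) :
    ∑ x, π x * (X.P ^ t) x y = π y := by
  have : Matrix.vecMul π (X.P ^ t) = π := by
    induction t with
    | zero => simp
    | succ t ih => rw [pow_succ, ← Matrix.vecMul_vecMul, ih, hπ.invariant]
  exact congrFun this y

theorem sum_mul_sum_P (hπ : X.IsStationary π) (f : Fin (n + 1) → ℝ) :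
    ∑ x, π x * ∑ y, X.P x y * f y = ∑ y, π y * f y := by
  simp only [Finset.mul_sum]
  rw [Finset.sum_comm]
  refine Finset.sum_congr rfl fun y _ => ?_
  rw [← hπ.sum_mul_P y, Finset.sum_mul]
  exact Finset.sum_congr rfl fun x _ => by ring

theorem pos (hπ : X.IsStationary π) (hirr : X.IsIrreducible) (y : Fin (n + 1)) : 0 < π y := by
  obtain ⟨x, hx⟩ : ∃ x, 0 < π x := by
    by_contra! h
    have : ∑ x, π x ≤ 0 := Finset.sum_nonpos fun x _ => h x
    linarith [hπ.sum_eq_one]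
  obtain ⟨m, -, hm⟩ := (Matrix.isIrreducible_iff_exists_pow_pos X.P_nonneg).1 hirr x y
  rw [← hπ.sum_mul_pow m y]
  have hpow : X.P ^ m ∈ Matrix.rowStochastic ℝ (Fin (n + 1)) := Submonoid.pow_mem _ X.stochastic m
  exact (mul_pos hx hm).trans_le (Finset.single_le_sum
    (f := fun x => π x * (X.P ^ m) x y) (fun z _ => mul_nonneg (hπ.nonneg z) (hpow.1 z y))
    (Finset.mem_univ x))

/-- Detailed balance along the edge `{k, k + 1}`: the stationary flux through the edge vanishes. -/
theorem balance (hπ : X.IsStationary π) {k : ℕ} (hk : k + 1 < n + 1) :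
    π ⟨k, by lia⟩ * X.up k = π ⟨k + 1, hk⟩ * X.dn (k + 1) := by
  have h := hπ.sum_mul_sum_P (fun x => if (x : ℕ) ≤ k then 1 else 0)
  have hs : ∀ x : Fin (n + 1), ∑ y, X.P x y * (if (y : ℕ) ≤ k then (1 : ℝ) else 0)
      = (if (x : ℕ) ≤ k then 1 else 0) - (if (x : ℕ) = k then X.up k else 0)
        + (if (x : ℕ) = k + 1 then X.dn (k + 1) else 0) := by
    intro x
    rw [X.sum_P_mul (fun j => if j ≤ k then 1 else 0) x]
    rcases lt_trichotomy (x : ℕ) k with hx | hx | hx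
    · rw [if_pos (by lia), if_pos (by lia), if_pos (by lia), if_neg (by lia), if_neg (by lia)]
      ring
    · rw [if_pos (by lia), if_neg (by lia), if_pos (by lia), if_pos (by lia), if_neg (by lia), hx]
      ring
    · rw [if_neg (by lia), if_neg (by lia)]
      by_cases hx' : (x : ℕ) = k + 1
      · rw [if_pos (by lia), if_neg (by lia), if_pos hx', hx']
        ring
      · rw [if_neg (by lia), if_neg (by lia), if_neg hx']
        ring
  simp only [hs, mul_add, mul_sub, Finset.sum_add_distrib, Finset.sum_sub_distrib] at h
  have e1 : ∑ x : Fin (n + 1), π x * (if (x : ℕ) = k then X.up k else 0)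
      = π ⟨k, by lia⟩ * X.up k := by
    rw [Finset.sum_eq_single (⟨k, by lia⟩ : Fin (n + 1))]
    · simp
    · intro y _ hy
      rw [if_neg fun h' => hy (Fin.ext h'), mul_zero]
    · simp
  have e2 : ∑ x : Fin (n + 1), π x * (if (x : ℕ) = k + 1 then X.dn (k + 1) else 0)
      = π ⟨k + 1, hk⟩ * X.dn (k + 1) := by
    rw [Finset.sum_eq_single (⟨k + 1, hk⟩ : Fin (n + 1))]
    · simp
    · intro y _ hy
      rw [if_neg fun h' => hy (Fin.ext h'), mul_zero]
    · simp
  rw [e1, e2] at h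
  linarith

theorem reversible (hπ : X.IsStationary π) (x y : Fin (n + 1)) :
    π x * X.P x y = π y * X.P y x := by
  have key : ∀ x y : Fin (n + 1), (x : ℕ) + 1 = y → π x * X.P x y = π y * X.P y x := by
    rintro ⟨x, hx⟩ ⟨y, hy⟩ rfl
    have := hπ.balance hy
    rwa [up, dif_pos hy, dn, dif_pos ⟨by lia, hy⟩] at this
  by_cases h1 : (x : ℕ) + 1 = y
  · exact key x y h1
  by_cases h2 : (y : ℕ) + 1 = x
  · exact (key y x h2).symm
  by_cases h3 : x = y
  · rw [h3]
  · have : (x : ℕ) ≠ y := fun h => h3 (Fin.ext h)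
    rw [X.P_eq_zero (by lia), X.P_eq_zero (by lia), mul_zero, mul_zero]

end IsStationary

theorem harmonic_eq_const (hirr : X.IsIrreducible) {f : Fin (n + 1) → ℝ}
    (hf : ∀ x, ∑ y, X.P x y * f y = f x) (x : Fin (n + 1)) : f x = f 0 := by
  -- `f` as a function on `ℕ`, constant beyond `n`, where `up` vanishes
  let F : ℕ → ℝ := fun k => f ⟨min k n, by lia⟩
  have hF : ∀ x : Fin (n + 1), F x = f x := fun x => congrArg f (Fin.ext (by simp; lia))
  have key : ∀ k, k ≤ n → F k = F 0 ∧ F (k - 1) = F 0 := by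
    intro k
    induction k with
    | zero => simp
    | succ k ih =>
      intro hk
      obtain ⟨h1, h2⟩ := ih (by lia)
      have h := X.sum_P_mul F ⟨k, by lia⟩
      simp only [hF, hf] at h
      rw [← hF] at h
      simp only [h1, h2] at h
      have h3 : X.up k * (F (k + 1) - F 0) = 0 := by linarith
      rcases mul_eq_zero.1 h3 with h4 | h4
      · exact absurd h4 (X.up_pos hirr (by lia)).ne'
      · exact ⟨by linarith, by simpa using h1⟩
  rw [← hF x, (key x (by lia)).1]
  rfl

/-- Laziness makes all eigenvalues nonnegative: compare the two sides of `P f = μ f` at a point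
where `|f|` is maximal. -/
theorem eigenvalue_mem_Icc (hlazy : X.IsLazy) {μ : ℝ} {f : Fin (n + 1) → ℝ} (hf0 : f ≠ 0)
    (hf : ∀ x, ∑ y, X.P x y * f y = μ * f x) : 0 ≤ μ ∧ μ ≤ 1 := by
  obtain ⟨x, -, hx⟩ := Finset.exists_max_image Finset.univ (fun x => |f x|) Finset.univ_nonempty
  have hpos : 0 < |f x| := by
    obtain ⟨y, hy⟩ := Function.ne_iff.1 hf0
    exact (abs_pos.2 hy).trans_le (hx y (Finset.mem_univ y))
  have h1 : (μ - X.P x x) * f x = ∑ y ∈ Finset.univ.erase x, X.P x y * f y := by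
    rw [sub_mul, ← hf x, ← Finset.add_sum_erase _ _ (Finset.mem_univ x)]
    ring
  have h2 : |μ - X.P x x| * |f x| ≤ (1 - X.P x x) * |f x| := by
    rw [← abs_mul, h1]
    refine (Finset.abs_sum_le_sum_abs _ _).trans ?_
    rw [← X.sum_P x, ← Finset.add_sum_erase _ _ (Finset.mem_univ x), add_sub_cancel_left,
      Finset.sum_mul]
    refine Finset.sum_le_sum fun y _ => ?_
    rw [abs_mul, abs_of_nonneg (X.P_nonneg x y)]
    exact mul_le_mul_of_nonneg_left (hx y (Finset.mem_univ y)) (X.P_nonneg x y)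
  have h3 := abs_le.1 (le_of_mul_le_mul_right h2 hpos)
  have h4 := hlazy x
  constructor <;> linarith [h3.1, h3.2]

theorem finite_abs_eigenvalues :
    {r : ℝ | ∃ μ : ℝ, Module.End.HasEigenvalue (Matrix.toLin' X.P) μ ∧ μ ≠ 1 ∧ r = |μ|}.Finite := by
  refine ((Module.End.finite_hasEigenvalue (Matrix.toLin' X.P)).image (fun μ => |μ|)).subset ?_
  rintro r ⟨μ, hμ, -, rfl⟩
  exact ⟨μ, hμ, rfl⟩

theorem exists_eigenfunction {μ : ℝ} (h : Module.End.HasEigenvalue (Matrix.toLin' X.P) μ) :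
    ∃ f : Fin (n + 1) → ℝ, f ≠ 0 ∧ ∀ x, ∑ y, X.P x y * f y = μ * f x := by
  obtain ⟨f, hf⟩ := h.exists_hasEigenvector
  exact ⟨f, hf.2, fun x => congrFun hf.apply_eq_smul x⟩

theorem hasEigenvalue_of_eigenfunction {μ : ℝ} {f : Fin (n + 1) → ℝ} (hf0 : f ≠ 0)
    (hf : ∀ x, ∑ y, X.P x y * f y = μ * f x) :
    Module.End.HasEigenvalue (Matrix.toLin' X.P) μ :=
  Module.End.hasEigenvalue_of_hasEigenvector (x := f)
    ⟨Module.End.mem_eigenspace_iff.2 (funext fun x => hf x), hf0⟩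

theorem gap_pos (hlazy : X.IsLazy) : 0 < X.gap := by
  unfold gap lambdaStar
  set S := {r : ℝ | ∃ μ : ℝ, Module.End.HasEigenvalue (Matrix.toLin' X.P) μ ∧ μ ≠ 1 ∧ r = |μ|}
    with hS
  rcases S.eq_empty_or_nonempty with h | h
  · rw [h, Real.sSup_empty]
    norm_num
  · obtain ⟨μ, hμ, hμ1, hr⟩ := h.csSup_mem X.finite_abs_eigenvalues
    obtain ⟨f, hf0, hf⟩ := X.exists_eigenfunction hμ
    obtain ⟨h0, h1⟩ := X.eigenvalue_mem_Icc hlazy hf0 hf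
    rw [hr, abs_of_nonneg h0]
    linarith [lt_of_le_of_ne h1 hμ1]

theorem trel_pos (hlazy : X.IsLazy) : 0 < X.trel := inv_pos.2 (X.gap_pos hlazy)

variable {X} in
/-- The spectral gap inequality on functions of mean zero: expand `√π f` in an orthonormal
eigenbasis of the symmetric matrix `√π(x) P(x, y) / √π(y)`. The eigenvectors of the eigenvalue `1`
are multiples of `√π`, hence orthogonal to `√π f`. -/
theorem IsStationary.gap_mul_le_of_mean_zero {π : Fin (n + 1) → ℝ} (hπ : X.IsStationary π)
    (hirr : X.IsIrreducible) {f : Fin (n + 1) → ℝ} (hf : ∑ x, π x * f x = 0) :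
    X.gap * ∑ x, π x * f x ^ 2 ≤ ∑ x, π x * (f x * (f x - ∑ y, X.P x y * f y)) := by
  have hpos := hπ.pos hirr
  have hs : ∀ x, 0 < √(π x) := fun x => Real.sqrt_pos.2 (hpos x)
  have hss : ∀ x, √(π x) * √(π x) = π x := fun x => Real.mul_self_sqrt (hpos x).le
  let S : Matrix (Fin (n + 1)) (Fin (n + 1)) ℝ :=
    Matrix.of fun x y => √(π x) * X.P x y / √(π y)
  have hS : S.IsHermitian := by
    ext x y
    simp only [Matrix.conjTranspose_apply, S, Matrix.of_apply, star_trivial]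
    rw [div_eq_div_iff (hs x).ne' (hs y).ne']
    have := hπ.reversible x y
    rw [← hss x, ← hss y] at this
    linarith
  let u : EuclideanSpace ℝ (Fin (n + 1)) := WithLp.toLp 2 fun x => √(π x) * f x
  let v := hS.eigenvectorBasis
  have hv : ∀ i x, ∑ y, X.P x y * (v i y / √(π y)) = hS.eigenvalues i * (v i x / √(π x)) := by
    intro i x
    have h := congrFun (hS.mulVec_eigenvectorBasis i) x
    simp only [Matrix.mulVec, dotProduct, S, Matrix.of_apply, Pi.smul_apply, smul_eq_mul] at h
    rw [← mul_div_assoc, eq_div_iff (hs x).ne', ← h, Finset.sum_mul]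
    refine Finset.sum_congr rfl fun y _ => ?_
    ring
  have hv0 : ∀ i, (fun x => v i x / √(π x)) ≠ 0 := by
    intro i h
    have h1 : v i = 0 := by
      ext x
      have := congrFun h x
      simpa [(hs x).ne'] using this
    have h2 := v.orthonormal.1 i
    rw [h1, norm_zero] at h2
    exact zero_ne_one h2
  have hbound : ∀ i,
      hS.eigenvalues i * inner ℝ (v i) u ^ 2 ≤ X.lambdaStar * inner ℝ (v i) u ^ 2 := by
    intro i
    by_cases h1 : hS.eigenvalues i = 1
    · have hconst := X.harmonic_eq_const hirr (f := fun x => v i x / √(π x)) fun x => by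
        rw [hv i x, h1, one_mul]
      have : inner ℝ (v i) u = 0 := by
        simp only [PiLp.inner_apply, u, RCLike.inner_apply, conj_trivial]
        have h2 : ∀ x, √(π x) * f x * v i x = v i 0 / √(π 0) * (π x * f x) := by
          intro x
          rw [← hconst x]
          have := (hs x).ne'
          nth_rewrite 3 [← hss x]
          field_simp
        rw [Finset.sum_congr rfl fun x _ => h2 x, ← Finset.mul_sum, hf, mul_zero]
      rw [this]
      simp
    · refine mul_le_mul_of_nonneg_right ((le_abs_self _).trans ?_) (sq_nonneg _)
      exact le_csSup X.finite_abs_eigenvalues.bddAbove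
        ⟨_, X.hasEigenvalue_of_eigenfunction (hv0 i) (hv i), h1, rfl⟩
  have hnorm : ∑ x, π x * f x ^ 2 = ∑ i, inner ℝ (v i) u ^ 2 := by
    have h1 := v.sum_inner_mul_inner u u
    have h2 : inner ℝ u u = ∑ x, π x * f x ^ 2 := by
      simp only [PiLp.inner_apply, u, RCLike.inner_apply, conj_trivial]
      refine Finset.sum_congr rfl fun x _ => ?_
      nth_rewrite 3 [← hss x]
      ring
    rw [← h2, ← h1]
    refine Finset.sum_congr rfl fun i _ => ?_
    rw [real_inner_comm]
    ring
  have hquad : ∑ x, π x * (f x * ∑ y, X.P x y * f y)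
      = ∑ i, hS.eigenvalues i * inner ℝ (v i) u ^ 2 := by
    let w : EuclideanSpace ℝ (Fin (n + 1)) := WithLp.toLp 2 fun x => √(π x) * ∑ y, X.P x y * f y
    have h1 := v.sum_inner_mul_inner u w
    have h2 : inner ℝ u w = ∑ x, π x * (f x * ∑ y, X.P x y * f y) := by
      simp only [PiLp.inner_apply, u, w, RCLike.inner_apply, conj_trivial]
      refine Finset.sum_congr rfl fun x _ => ?_
      nth_rewrite 3 [← hss x]
      ring
    have h3 : ∀ i, inner ℝ (v i) w = hS.eigenvalues i * inner ℝ (v i) u := by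
      intro i
      simp only [PiLp.inner_apply, u, w, RCLike.inner_apply, conj_trivial]
      have e : ∀ x, (√(π x) * ∑ y, X.P x y * f y) * v i x
          = ∑ y, π x * X.P x y * (v i x / √(π x)) * f y := by
        intro x
        have := (hs x).ne'
        rw [Finset.mul_sum, Finset.sum_mul]
        refine Finset.sum_congr rfl fun y _ => ?_
        nth_rewrite 2 [← hss x]
        field_simp
      rw [Finset.sum_congr rfl fun x _ => e x, Finset.sum_comm, Finset.mul_sum]
      refine Finset.sum_congr rfl fun y _ => ?_
      have e2 : ∑ x, π x * X.P x y * (v i x / √(π x)) * f y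
          = π y * f y * ∑ x, X.P y x * (v i x / √(π x)) := by
        rw [Finset.mul_sum]
        refine Finset.sum_congr rfl fun x _ => ?_
        rw [hπ.reversible x y]
        ring
      rw [e2, hv i y]
      have := (hs y).ne'
      nth_rewrite 1 [← hss y]
      field_simp
    rw [← h2, ← h1]
    refine Finset.sum_congr rfl fun i _ => ?_
    rw [h3, real_inner_comm]
    ring
  have hsum := Finset.sum_le_sum fun i (_ : i ∈ Finset.univ) => hbound i
  rw [← hquad, ← Finset.mul_sum, ← hnorm] at hsum
  have hexp : ∑ x, π x * (f x * (f x - ∑ y, X.P x y * f y))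
      = ∑ x, π x * f x ^ 2 - ∑ x, π x * (f x * ∑ y, X.P x y * f y) := by
    rw [← Finset.sum_sub_distrib]
    exact Finset.sum_congr rfl fun x _ => by ring
  rw [hexp]
  unfold gap
  linarith

variable {X} in
/-- The Poincaré inequality `Var_π f ≤ t_rel ⟨f, (I - P) f⟩_π`. -/
theorem IsStationary.poincare {π : Fin (n + 1) → ℝ} (hπ : X.IsStationary π)
    (hlazy : X.IsLazy) (hirr : X.IsIrreducible) (f : Fin (n + 1) → ℝ) :
    ∑ x, π x * (f x - ∑ y, π y * f y) ^ 2
      ≤ X.trel * ∑ x, π x * (f x * (f x - ∑ y, X.P x y * f y)) := by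
  set m := ∑ y, π y * f y with hm
  have h0 : ∑ x, π x * (f x - m) = 0 := by
    simp only [mul_sub, Finset.sum_sub_distrib, ← Finset.sum_mul, hπ.sum_eq_one, one_mul]
    rw [← hm, sub_self]
  have h := hπ.gap_mul_le_of_mean_zero hirr h0
  have h1 : ∀ x, (f x - m) - ∑ y, X.P x y * (f y - m) = f x - ∑ y, X.P x y * f y := by
    intro x
    simp only [mul_sub, Finset.sum_sub_distrib, ← Finset.sum_mul, X.sum_P, one_mul]
    ring
  have h2 : ∑ x, π x * ((f x - m) * (f x - ∑ y, X.P x y * f y))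
      = ∑ x, π x * (f x * (f x - ∑ y, X.P x y * f y)) := by
    have h3 : ∑ x, π x * (f x - ∑ y, X.P x y * f y) = 0 := by
      simp only [mul_sub, Finset.sum_sub_distrib, hπ.sum_mul_sum_P, sub_self]
    rw [← sub_zero (∑ x, π x * (f x * (f x - ∑ y, X.P x y * f y))), ← mul_zero m, ← h3,
      Finset.mul_sum, ← Finset.sum_sub_distrib]
    exact Finset.sum_congr rfl fun x _ => by ring
  simp only [h1] at h
  rw [h2] at h
  rw [trel, inv_mul_eq_div, le_div_iff₀ (X.gap_pos hlazy), mul_comm]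
  exact h

end BirthDeathChain

/-! ### The Green operator and mean hitting times -/

namespace BirthDeathChain

variable {n : ℕ} (X : BirthDeathChain n)

/-- The conductance `π(k) P(k, k + 1)` of the edge `{k, k + 1}`. -/
def conductance (π : Fin (n + 1) → ℝ) (k : ℕ) : ℝ :=
  if h : k < n + 1 then π ⟨k, h⟩ * X.up k else 0

/-- The effective resistance between `k` and `b`; it is `0` for `k ≥ b`. -/
def resistance (π : Fin (n + 1) → ℝ) (b k : ℕ) : ℝ :=
  ∑ i ∈ Finset.Ico k b, (X.conductance π i)⁻¹

/-- The Green operator of the chain that starts at most at `b` and is killed at `b`. Its kernel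
with respect to `π` is `(x, y) ↦ R(max x y)`, where `R` is the resistance to `b`. -/
def greenOp (π : Fin (n + 1) → ℝ) (b : ℕ) (f : Fin (n + 1) → ℝ) (x : ℕ) : ℝ :=
  ∑ y, π y * X.resistance π b (max x y) * f y

/-- The mean hitting time of `b` from `x ≤ b`, as the Green operator applied to the constant `1`. -/
def meanHit (π : Fin (n + 1) → ℝ) (b x : ℕ) : ℝ :=
  X.greenOp π b (fun _ => 1) x

theorem resistance_of_le {π : Fin (n + 1) → ℝ} {b k : ℕ} (h : b ≤ k) :
    X.resistance π b k = 0 := by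
  simp [resistance, Finset.Ico_eq_empty_of_le h]

theorem resistance_succ {π : Fin (n + 1) → ℝ} {b k : ℕ} (h : k < b) :
    X.resistance π b k = (X.conductance π k)⁻¹ + X.resistance π b (k + 1) := by
  unfold resistance
  rw [Finset.sum_eq_sum_Ico_succ_bot h]

theorem resistance_split {π : Fin (n + 1) → ℝ} {m b k : ℕ} (h : m ≤ b) :
    X.resistance π b k = X.resistance π m k + X.resistance π b (max k m) := by
  rcases le_total k m with hk | hk
  · rw [max_eq_right hk]
    exact (Finset.sum_Ico_consecutive _ hk h).symm
  · rw [max_eq_left hk, X.resistance_of_le hk, zero_add]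

theorem greenOp_of_le {π : Fin (n + 1) → ℝ} {b x : ℕ} (f : Fin (n + 1) → ℝ) (h : b ≤ x) :
    X.greenOp π b f x = 0 := by
  unfold greenOp
  refine Finset.sum_eq_zero fun y _ => ?_
  rw [X.resistance_of_le (h.trans (le_max_left _ _)), mul_zero, zero_mul]

namespace IsStationary

variable {X} {π : Fin (n + 1) → ℝ}

theorem conductance_nonneg (hπ : X.IsStationary π) (k : ℕ) : 0 ≤ X.conductance π k := by
  unfold conductance
  split_ifs
  · exact mul_nonneg (hπ.nonneg _) (X.up_nonneg k)
  · exact le_rfl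

theorem conductance_pos (hπ : X.IsStationary π) (hirr : X.IsIrreducible) {k : ℕ} (hk : k < n) :
    0 < X.conductance π k := by
  rw [conductance, dif_pos (by lia)]
  exact mul_pos (hπ.pos hirr _) (X.up_pos hirr hk)

theorem resistance_nonneg (hπ : X.IsStationary π) (b k : ℕ) : 0 ≤ X.resistance π b k :=
  Finset.sum_nonneg fun i _ => inv_nonneg.2 (hπ.conductance_nonneg i)

theorem resistance_anti (hπ : X.IsStationary π) (b : ℕ) {k l : ℕ} (h : k ≤ l) :
    X.resistance π b l ≤ X.resistance π b k :=
  Finset.sum_le_sum_of_subset_of_nonneg (Finset.Ico_subset_Ico_left h)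
    fun i _ _ => inv_nonneg.2 (hπ.conductance_nonneg i)

/-- `(I - P) R(max · y) = δ_y / π(y)` on `{0, …, b - 1}`. -/
theorem sum_P_mul_resistance (hπ : X.IsStationary π) (hirr : X.IsIrreducible) {b : Fin (n + 1)}
    {x : Fin (n + 1)} (hx : x < b) (y : Fin (n + 1)) :
    ∑ z, X.P x z * X.resistance π b (max z y)
      = X.resistance π b (max x y) - if x = y then (π x)⁻¹ else 0 := by
  have hxb : (x : ℕ) < b := hx
  have hup : X.up x * (X.conductance π x)⁻¹ = (π x)⁻¹ := by
    have h1 : X.conductance π x = π x * X.up x := by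
      rw [conductance, dif_pos x.2]
    have h2 := (X.up_pos hirr (k := x) (by lia)).ne'
    rw [h1, mul_inv, mul_left_comm, mul_inv_cancel₀ h2, mul_one]
  rw [X.sum_P_mul (fun k => X.resistance π b (max k y)) x]
  rcases lt_trichotomy (x : ℕ) y with h | h | h
  · rw [if_neg (Fin.ne_of_lt h), max_eq_right (by lia), max_eq_right (by lia),
      max_eq_right (by lia)]
    ring
  · have hxy : x = y := Fin.ext h
    subst hxy
    rw [if_pos rfl, max_eq_left (by lia), max_eq_left (by lia), max_eq_right (by lia),
      X.resistance_succ hxb, ← hup]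
    ring
  · have hdn : X.dn x * (X.conductance π (x - 1 : ℕ))⁻¹ = (π x)⁻¹ := by
      have h0 : ((x : ℕ) - 1) + 1 = x := by lia
      have h1 := hπ.balance (k := (x : ℕ) - 1) (by lia)
      have h2 : X.conductance π (x - 1 : ℕ) = π x * X.dn x := by
        rw [conductance, dif_pos (by lia), h1]
        congr 2
        · exact Fin.ext h0
      have h3 := (hπ.conductance_pos hirr (k := (x : ℕ) - 1) (by lia)).ne'
      rw [h2] at h3 ⊢
      rw [mul_inv, mul_left_comm, mul_inv_cancel₀ (right_ne_zero_of_mul h3), mul_one]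
    have h4 := X.resistance_succ (π := π) (b := b) (k := (x : ℕ) - 1) (by lia)
    rw [show ((x : ℕ) - 1) + 1 = x by lia] at h4
    rw [if_neg (Fin.ne_of_gt h), max_eq_left (by lia), max_eq_left (by lia),
      max_eq_left (by lia), h4, X.resistance_succ hxb]
    linear_combination hdn - hup

theorem sum_P_mul_greenOp (hπ : X.IsStationary π) (hirr : X.IsIrreducible) {b : Fin (n + 1)}
    (f : Fin (n + 1) → ℝ) {x : Fin (n + 1)} (hx : x < b) :
    ∑ z, X.P x z * X.greenOp π b f z = X.greenOp π b f x - f x := by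
  have h1 : ∑ z, X.P x z * X.greenOp π b f z
      = ∑ y, π y * f y * ∑ z, X.P x z * X.resistance π b (max z y) := by
    simp only [greenOp, Finset.mul_sum]
    rw [Finset.sum_comm]
    exact Finset.sum_congr rfl fun y _ => Finset.sum_congr rfl fun z _ => by ring
  have h2 : ∀ y, π y * f y * (X.resistance π b (max x y) - if x = y then (π x)⁻¹ else 0)
      = π y * X.resistance π b (max x y) * f y - if x = y then f x else 0 := by
    intro y
    split_ifs with h
    · subst h
      have := (hπ.pos hirr x).ne'
      field_simp
    · ring
  simp only [h1, hπ.sum_P_mul_resistance hirr hx, h2, Finset.sum_sub_distrib, Finset.sum_ite_eq,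
    Finset.mem_univ, if_true]
  rfl

theorem sum_P_mul_meanHit (hπ : X.IsStationary π) (hirr : X.IsIrreducible) {b : Fin (n + 1)}
    {x : Fin (n + 1)} (hx : x < b) :
    ∑ z, X.P x z * X.meanHit π b z = X.meanHit π b x - 1 :=
  hπ.sum_P_mul_greenOp hirr _ hx

theorem meanHit_nonneg (hπ : X.IsStationary π) (b x : ℕ) : 0 ≤ X.meanHit π b x := by
  unfold meanHit greenOp
  exact Finset.sum_nonneg fun y _ =>
    mul_nonneg (mul_nonneg (hπ.nonneg y) (hπ.resistance_nonneg _ _)) zero_le_one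

theorem meanHit_anti (hπ : X.IsStationary π) (b : ℕ) {k l : ℕ} (h : k ≤ l) :
    X.meanHit π b l ≤ X.meanHit π b k := by
  unfold meanHit greenOp
  refine Finset.sum_le_sum fun y _ => ?_
  rw [mul_one, mul_one]
  exact mul_le_mul_of_nonneg_left (hπ.resistance_anti b (max_le_max_right _ h)) (hπ.nonneg y)

end IsStationary

theorem meanHit_self {π : Fin (n + 1) → ℝ} (b : ℕ) : X.meanHit π b b = 0 :=
  X.greenOp_of_le _ le_rfl

/-- `𝔼_0 τ_b = 𝔼_0 τ_m + 𝔼_m τ_b` for `m ≤ b`. -/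
theorem meanHit_zero_add {π : Fin (n + 1) → ℝ} {m b : ℕ} (h : m ≤ b) :
    X.meanHit π b 0 = X.meanHit π m 0 + X.meanHit π b m := by
  unfold meanHit greenOp
  rw [← Finset.sum_add_distrib]
  refine Finset.sum_congr rfl fun y _ => ?_
  rw [max_eq_right (Nat.zero_le _), X.resistance_split h, max_comm]
  ring

theorem le_of_P_ne_zero {x z b : Fin (n + 1)} (hx : x < b) (hz : X.P x z ≠ 0) : z ≤ b := by
  by_contra h
  have h1 : (b : ℕ) < z := not_le.1 h
  have h2 : (x : ℕ) < b := hx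
  exact hz (X.P_eq_zero (by lia))

/-- Before the chain reaches `b`, averaging over one step only sees values on `{0, …, b}`. -/
theorem sum_P_mul_mono {x b : Fin (n + 1)} (hx : x < b) {f g : Fin (n + 1) → ℝ}
    (h : ∀ z ≤ b, f z ≤ g z) : ∑ z, X.P x z * f z ≤ ∑ z, X.P x z * g z := by
  refine Finset.sum_le_sum fun z _ => ?_
  by_cases hz : X.P x z = 0
  · rw [hz, zero_mul, zero_mul]
  · exact mul_le_mul_of_nonneg_left (h z (X.le_of_P_ne_zero hx hz)) (X.P_nonneg x z)

theorem sum_P_mul_affine (x : Fin (n + 1)) (f : Fin (n + 1) → ℝ) (c d : ℝ) :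
    ∑ z, X.P x z * (c * f z + d) = c * ∑ z, X.P x z * f z + d := by
  have : ∀ z, X.P x z * (c * f z + d) = c * (X.P x z * f z) + X.P x z * d := fun z => by ring
  rw [Finset.sum_congr rfl fun z _ => this z, Finset.sum_add_distrib, ← Finset.mul_sum,
    ← Finset.sum_mul, X.sum_P, one_mul]

namespace IsStationary

variable {X} {π : Fin (n + 1) → ℝ}

theorem sum_surv_le (hπ : X.IsStationary π) (hirr : X.IsIrreducible) (b : Fin (n + 1)) (T : ℕ) :
    ∀ x ≤ b, ∑ t ∈ Finset.range T, X.surv b t x ≤ X.meanHit π b x := by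
  induction T with
  | zero =>
    intro x _
    simpa using hπ.meanHit_nonneg b x
  | succ T ih =>
    intro x hx
    rcases eq_or_lt_of_le hx with rfl | hx
    · simp [surv_self, X.meanHit_self]
    · rw [Finset.sum_range_succ', X.surv_zero hx.ne]
      have h := X.sum_P_mul_mono hx ih
      rw [hπ.sum_P_mul_meanHit hirr hx] at h
      simp only [Finset.mul_sum] at h
      rw [Finset.sum_comm] at h
      simp only [← X.surv_succ hx.ne] at h
      linarith

theorem summable_surv (hπ : X.IsStationary π) (hirr : X.IsIrreducible) {b x : Fin (n + 1)}
    (hx : x ≤ b) : Summable fun t => X.surv b t x :=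
  summable_of_sum_range_le (fun t => X.surv_nonneg b t x) fun T => hπ.sum_surv_le hirr b T x hx

theorem meanHit_le_sum_surv (hπ : X.IsStationary π) (hirr : X.IsIrreducible) (b : Fin (n + 1))
    (T : ℕ) : ∀ x ≤ b, X.meanHit π b x
      ≤ ∑ t ∈ Finset.range T, X.surv b t x + X.meanHit π b 0 * X.surv b T x := by
  induction T with
  | zero =>
    intro x hx
    rcases eq_or_lt_of_le hx with rfl | hx
    · simp [surv_self, X.meanHit_self]
    · simpa [X.surv_zero hx.ne] using hπ.meanHit_anti b (Nat.zero_le x)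
  | succ T ih =>
    intro x hx
    rcases eq_or_lt_of_le hx with rfl | hx
    · simp [surv_self, X.meanHit_self]
    · rw [Finset.sum_range_succ', X.surv_zero hx.ne]
      have h := X.sum_P_mul_mono hx ih
      rw [hπ.sum_P_mul_meanHit hirr hx] at h
      simp only [mul_add, Finset.sum_add_distrib, Finset.mul_sum] at h
      rw [Finset.sum_comm] at h
      have h2 : ∑ z, X.P x z * (X.meanHit π b 0 * X.surv b T z)
          = X.meanHit π b 0 * X.surv b (T + 1) x := by
        rw [X.surv_succ hx.ne, Finset.mul_sum]
        exact Finset.sum_congr rfl fun z _ => by ring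
      rw [h2] at h
      simp only [← X.surv_succ hx.ne] at h
      linarith

theorem hasSum_surv (hπ : X.IsStationary π) (hirr : X.IsIrreducible) {b x : Fin (n + 1)}
    (hx : x ≤ b) : HasSum (fun t => X.surv b t x) (X.meanHit π b x) := by
  have hs := hπ.summable_surv hirr hx
  have h1 := hs.hasSum.tendsto_sum_nat
  have h2 := h1.add (hs.tendsto_atTop_zero.const_mul (X.meanHit π b 0))
  rw [mul_zero, add_zero] at h2
  have h3 : X.meanHit π b x = ∑' t, X.surv b t x :=
    le_antisymm (ge_of_tendsto' h2 fun T => hπ.meanHit_le_sum_surv hirr b T x hx)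
      (le_of_tendsto' h1 fun T => hπ.sum_surv_le hirr b T x hx)
  rw [h3]
  exact hs.hasSum

theorem expHit_eq (hπ : X.IsStationary π) (hirr : X.IsIrreducible) {b x : Fin (n + 1)}
    (hx : x ≤ b) : X.expHit x b = ENNReal.ofReal (X.meanHit π b x) := by
  rw [expHit_eq_tsum, ← (hπ.hasSum_surv hirr hx).tsum_eq,
    ENNReal.ofReal_tsum_of_nonneg (fun t => X.surv_nonneg b t x) (hπ.summable_surv hirr hx)]

/-- The minimum principle on `{0, …, b}`, by optional stopping at `b`. -/
theorem nonneg_of_superharmonic (hπ : X.IsStationary π) (hirr : X.IsIrreducible)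
    {b : Fin (n + 1)} {F : Fin (n + 1) → ℝ} (hb : 0 ≤ F b)
    (hF : ∀ x < b, ∑ z, X.P x z * F z ≤ F x) : ∀ x ≤ b, 0 ≤ F x := by
  intro x hx
  obtain ⟨K, hK⟩ : ∃ K : ℝ, ∀ z, -F z ≤ K := by
    obtain ⟨K, hK⟩ := (Set.finite_range fun z => -F z).bddAbove
    exact ⟨K, fun z => hK ⟨z, rfl⟩⟩
  have key : ∀ T : ℕ, ∀ x ≤ b, -(K * X.surv b T x) ≤ F x := by
    intro T
    induction T with
    | zero =>
      intro x hx
      rcases eq_or_lt_of_le hx with rfl | hx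
      · simpa [surv_self] using hb
      · rw [X.surv_zero hx.ne]
        linarith [hK x]
    | succ T ih =>
      intro x hx
      rcases eq_or_lt_of_le hx with rfl | hx
      · simpa [surv_self] using hb
      · refine le_trans (le_of_eq ?_) ((X.sum_P_mul_mono hx ih).trans (hF x hx))
        rw [X.surv_succ hx.ne, Finset.mul_sum, ← Finset.sum_neg_distrib]
        exact Finset.sum_congr rfl fun z _ => by ring
  have h := ((hπ.summable_surv hirr hx).tendsto_atTop_zero.const_mul K).neg
  rw [mul_zero, neg_zero] at h
  exact le_of_tendsto' h fun T => key T x hx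

/-- Markov's inequality for `ℙ_x(τ_b > t)`, in the form that is inductive in `t`. -/
theorem add_mul_surv_le (hπ : X.IsStationary π) (hirr : X.IsIrreducible) (b : Fin (n + 1))
    (t : ℕ) : ∀ d : ℝ, 0 ≤ d → ∀ x ≤ b, (d + t + 1) * X.surv b t x ≤ X.meanHit π b x + d := by
  induction t with
  | zero =>
    intro d hd x hx
    rcases eq_or_lt_of_le hx with rfl | hx
    · simpa [surv_self, X.meanHit_self] using hd
    · have := hπ.sum_surv_le hirr b 1 x hx.le
      simp only [Finset.sum_range_one, X.surv_zero hx.ne] at this ⊢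
      push_cast
      linarith
  | succ t ih =>
    intro d hd x hx
    rcases eq_or_lt_of_le hx with rfl | hx
    · simpa [surv_self, X.meanHit_self] using hd
    · have h := X.sum_P_mul_mono hx (ih (d + 1) (by linarith))
      have h1 := X.sum_P_mul_affine x (fun z => X.meanHit π b z) 1 (d + 1)
      have h2 := X.sum_P_mul_affine x (X.surv b t) (d + 1 + t + 1) 0
      simp only [one_mul, add_zero] at h1 h2
      rw [h1, h2, ← X.surv_succ hx.ne, hπ.sum_P_mul_meanHit hirr hx] at h
      push_cast
      linarith

end IsStationary

end BirthDeathChain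

/-! ### Concentration of hitting times -/

namespace BirthDeathChain

variable {n : ℕ} (X : BirthDeathChain n)

/-- The variance of the hitting time of `b` from `x ≤ b`: with `g` the mean and `w = G g`, the
second moment is `2 w - g`. -/
def varHit (π : Fin (n + 1) → ℝ) (b x : ℕ) : ℝ :=
  2 * X.greenOp π b (fun z => X.meanHit π b z) x - X.meanHit π b x - X.meanHit π b x ^ 2

theorem varHit_self {π : Fin (n + 1) → ℝ} (b : ℕ) : X.varHit π b b = 0 := by
  simp [varHit, meanHit_self, X.greenOp_of_le _ le_rfl]

namespace IsStationary

variable {X} {π : Fin (n + 1) → ℝ}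

/-- First-step analysis of `𝔼_x[(τ_b + d)²] = Var_x τ_b + (𝔼_x τ_b + d)²`. -/
theorem sum_P_mul_varHit (hπ : X.IsStationary π) (hirr : X.IsIrreducible) {b : Fin (n + 1)}
    {x : Fin (n + 1)} (hx : x < b) (d : ℝ) :
    ∑ z, X.P x z * (X.varHit π b z + (X.meanHit π b z + (d + 1)) ^ 2)
      = X.varHit π b x + (X.meanHit π b x + d) ^ 2 := by
  have h1 := hπ.sum_P_mul_greenOp hirr (fun z => X.meanHit π b z) hx
  have h2 := hπ.sum_P_mul_meanHit hirr hx
  have h3 : ∀ z : Fin (n + 1), X.P x z * (X.varHit π b z + (X.meanHit π b z + (d + 1)) ^ 2)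
      = 2 * (X.P x z * X.greenOp π b (fun z => X.meanHit π b z) z)
        + (2 * d + 1) * (X.P x z * X.meanHit π b z) + X.P x z * (d + 1) ^ 2 := by
    intro z
    unfold varHit
    ring
  rw [Finset.sum_congr rfl fun z _ => h3 z, Finset.sum_add_distrib, Finset.sum_add_distrib,
    ← Finset.mul_sum, ← Finset.mul_sum, ← Finset.sum_mul, h1, h2, X.sum_P]
  unfold varHit
  ring

theorem varHit_nonneg (hπ : X.IsStationary π) (hirr : X.IsIrreducible) {b : Fin (n + 1)} :
    ∀ x ≤ b, 0 ≤ X.varHit π b x := by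
  refine hπ.nonneg_of_superharmonic hirr (F := fun x => X.varHit π b x) (X.varHit_self b).ge
    fun x hx => ?_
  -- `Var` is superharmonic, since the square of the mean hitting time satisfies Jensen's inequality
  have h := hπ.sum_P_mul_varHit hirr hx (-X.meanHit π b x)
  rw [add_neg_cancel, zero_pow two_ne_zero, add_zero] at h
  rw [← h]
  refine Finset.sum_le_sum fun z _ => mul_le_mul_of_nonneg_left ?_ (X.P_nonneg x z)
  linarith [sq_nonneg (X.meanHit π b z + (-X.meanHit π b x + 1))]

theorem one_le_meanHit (hπ : X.IsStationary π) (hirr : X.IsIrreducible) {b x : Fin (n + 1)}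
    (hx : x < b) : 1 ≤ X.meanHit π b x := by
  have h := hπ.sum_surv_le hirr b 1 x hx.le
  rwa [Finset.sum_range_one, X.surv_zero hx.ne] at h

/-- `ℙ_x(τ_b > t) (t + 1 + d)² ≤ 𝔼_x[(τ_b + d)²]`, by induction on `t`. -/
theorem surv_mul_sq_le (hπ : X.IsStationary π) (hirr : X.IsIrreducible) (b : Fin (n + 1)) (t : ℕ) :
    ∀ d : ℝ, 0 ≤ d + t + 1 → ∀ x ≤ b,
      X.surv b t x * (d + t + 1) ^ 2 ≤ X.varHit π b x + (X.meanHit π b x + d) ^ 2 := by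
  induction t with
  | zero =>
    intro d hd x hx
    rcases eq_or_lt_of_le hx with rfl | hx
    · rw [X.surv_self, X.varHit_self, zero_mul, zero_add]
      exact sq_nonneg _
    · rw [X.surv_zero hx.ne]
      have h1 := hπ.one_le_meanHit hirr hx
      have h2 := hπ.varHit_nonneg hirr x hx.le
      push_cast at hd ⊢
      nlinarith
  | succ t ih =>
    intro d hd x hx
    push_cast at hd
    rcases eq_or_lt_of_le hx with rfl | hx
    · rw [X.surv_self, X.varHit_self, zero_mul, zero_add]
      exact sq_nonneg _
    · have h := X.sum_P_mul_mono hx (ih (d + 1) (by linarith))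
      rw [hπ.sum_P_mul_varHit hirr hx] at h
      refine le_trans (le_of_eq ?_) h
      rw [X.surv_succ hx.ne, Finset.sum_mul]
      refine Finset.sum_congr rfl fun z _ => ?_
      push_cast
      ring

/-- `ℙ_x(τ_b ≤ t) (t + d)² ≤ 𝔼_x[(τ_b + d)²]` for `t + d ≤ 0`, by induction on `t`. -/
theorem one_sub_surv_mul_sq_le (hπ : X.IsStationary π) (hirr : X.IsIrreducible)
    (b : Fin (n + 1)) (t : ℕ) :
    ∀ d : ℝ, d + t ≤ 0 → ∀ x ≤ b,
      (1 - X.surv b t x) * (d + t) ^ 2 ≤ X.varHit π b x + (X.meanHit π b x + d) ^ 2 := by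
  induction t with
  | zero =>
    intro d hd x hx
    rcases eq_or_lt_of_le hx with rfl | hx
    · rw [X.surv_self, X.varHit_self, X.meanHit_self]
      simp
    · rw [X.surv_zero hx.ne, sub_self, zero_mul]
      have h2 := hπ.varHit_nonneg hirr x hx.le
      positivity
  | succ t ih =>
    intro d hd x hx
    push_cast at hd
    rcases eq_or_lt_of_le hx with rfl | hx
    · rw [X.surv_self, X.varHit_self, X.meanHit_self]
      have : (0 : ℝ) ≤ t := t.cast_nonneg
      push_cast
      nlinarith
    · have h := X.sum_P_mul_mono hx (ih (d + 1) (by linarith))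
      rw [hπ.sum_P_mul_varHit hirr hx] at h
      refine le_trans (le_of_eq ?_) h
      have h1 := X.sum_P_mul_affine x (X.surv b t) (-(d + 1 + t) ^ 2) ((d + 1 + t) ^ 2)
      rw [← X.surv_succ hx.ne] at h1
      calc (1 - X.surv b (t + 1) x) * (d + ((t + 1 : ℕ) : ℝ)) ^ 2
          = -(d + 1 + t) ^ 2 * X.surv b (t + 1) x + (d + 1 + t) ^ 2 := by push_cast; ring
        _ = _ := by
          rw [← h1]
          exact Finset.sum_congr rfl fun z _ => by ring

/-- A lower bound for the bottom of the Dirichlet spectrum: the spectral gap inequality for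
functions that vanish on `{b, …, n}`. -/
theorem dirichlet_poincare (hπ : X.IsStationary π) (hlazy : X.IsLazy) (hirr : X.IsIrreducible)
    {b : Fin (n + 1)} {f : Fin (n + 1) → ℝ} (hf : ∀ x, b ≤ x → f x = 0) :
    (∑ y ∈ Finset.Ici b, π y) * ∑ x, π x * f x ^ 2
      ≤ X.trel * ∑ x, π x * (f x * (f x - ∑ y, X.P x y * f y)) := by
  refine le_trans ?_ (hπ.poincare hlazy hirr f)
  set m := ∑ y, π y * f y with hm
  have h1 : ∑ x, π x * (f x - m) ^ 2 = ∑ x, π x * f x ^ 2 - m ^ 2 := by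
    have : ∀ x, π x * (f x - m) ^ 2 = π x * f x ^ 2 - 2 * m * (π x * f x) + π x * m ^ 2 :=
      fun x => by ring
    rw [Finset.sum_congr rfl fun x _ => this x, Finset.sum_add_distrib, Finset.sum_sub_distrib,
      ← Finset.mul_sum, ← hm, ← Finset.sum_mul, hπ.sum_eq_one]
    ring
  have h2 : m = ∑ y ∈ Finset.Iio b, π y * f y := by
    rw [hm]
    refine (Finset.sum_subset (Finset.subset_univ _) fun y _ hy => ?_).symm
    rw [hf y (not_lt.1 fun h => hy (Finset.mem_Iio.2 h)), mul_zero]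
  have h3 : ∑ x, π x * f x ^ 2 = ∑ y ∈ Finset.Iio b, π y * f y ^ 2 := by
    refine (Finset.sum_subset (Finset.subset_univ _) fun y _ hy => ?_).symm
    rw [hf y (not_lt.1 fun h => hy (Finset.mem_Iio.2 h)), zero_pow two_ne_zero, mul_zero]
  have h4 : m ^ 2 ≤ (∑ y ∈ Finset.Iio b, π y) * ∑ y ∈ Finset.Iio b, π y * f y ^ 2 := by
    rw [h2]
    exact Finset.sum_sq_le_sum_mul_sum_of_sq_le_mul _ (fun y _ => hπ.nonneg y)
      (fun y _ => mul_nonneg (hπ.nonneg y) (sq_nonneg _)) fun y _ => le_of_eq (by ring)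
  have h5 : ∑ y ∈ Finset.Iio b, π y + ∑ y ∈ Finset.Ici b, π y = 1 := by
    rw [← hπ.sum_eq_one, ← Finset.sum_filter_add_sum_filter_not Finset.univ (fun y => y < b)]
    congr 1 <;> refine Finset.sum_congr ?_ fun _ _ => rfl <;> ext y <;> simp
  rw [h1]
  rw [← h3] at h4
  have : ∑ y ∈ Finset.Iio b, π y = 1 - ∑ y ∈ Finset.Ici b, π y := by linarith
  rw [this] at h4
  linarith

/-- The trace formula `Var_0 τ_b = tr G² - tr G` for the Green operator `G`. It rests on
`G(0, y) = G(y, y)`, which holds since the walk from `0` visits every state below `b`; the sum over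
`y, z` is symmetrized to replace `2 R(y) R(max y z) - R(y) R(z)` by `R(max y z)²`. -/
theorem varHit_zero (X : BirthDeathChain n) (π : Fin (n + 1) → ℝ) (b : ℕ) :
    X.varHit π b 0
      = ∑ y, π y * ∑ z, π z * X.resistance π b (max z y) ^ 2 - X.meanHit π b 0 := by
  set R : ℕ → ℝ := X.resistance π b with hR
  have hg : X.meanHit π b 0 = ∑ y, π y * R y := by
    simp [meanHit, greenOp, hR]
  have hw : X.greenOp π b (fun z => X.meanHit π b z) 0
      = ∑ y : Fin (n + 1), ∑ z : Fin (n + 1), π y * π z * (R y * R (max y z)) := by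
    simp only [greenOp, meanHit, Nat.zero_le, max_eq_right, mul_one, ← hR, Finset.mul_sum]
    exact Finset.sum_congr rfl fun y _ => Finset.sum_congr rfl fun z _ => by ring
  have hw' : X.greenOp π b (fun z => X.meanHit π b z) 0
      = ∑ y : Fin (n + 1), ∑ z : Fin (n + 1), π y * π z * (R z * R (max y z)) := by
    rw [hw, Finset.sum_comm]
    refine Finset.sum_congr rfl fun y _ => Finset.sum_congr rfl fun z _ => ?_
    rw [max_comm]
    ring
  have hg2 : X.meanHit π b 0 ^ 2
      = ∑ y : Fin (n + 1), ∑ z : Fin (n + 1), π y * π z * (R y * R z) := by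
    rw [hg, sq, Finset.sum_mul_sum]
    exact Finset.sum_congr rfl fun y _ => Finset.sum_congr rfl fun z _ => by ring
  have key : 2 * X.greenOp π b (fun z => X.meanHit π b z) 0 - X.meanHit π b 0 ^ 2
      = ∑ y, π y * ∑ z, π z * R (max z y) ^ 2 := by
    rw [two_mul]
    nth_rewrite 1 [hw]
    rw [hw', hg2]
    simp only [Finset.mul_sum, ← Finset.sum_add_distrib, ← Finset.sum_sub_distrib]
    refine Finset.sum_congr rfl fun y _ => Finset.sum_congr rfl fun z _ => ?_
    rcases le_total (y : ℕ) z with h | h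
    · rw [max_eq_right h, max_eq_left h]
      ring
    · rw [max_eq_left h, max_eq_right h]
      ring
  unfold varHit
  linarith

/-- The hitting time of `b` from `0` is concentrated: its variance is at most
`t_rel / π([b, n])` times its mean. -/
theorem varHit_le (hπ : X.IsStationary π) (hlazy : X.IsLazy) (hirr : X.IsIrreducible)
    (b : Fin (n + 1)) :
    (∑ y ∈ Finset.Ici b, π y) * X.varHit π b 0 ≤ X.trel * X.meanHit π b 0 := by
  have h1 : ∀ y : Fin (n + 1),
      (∑ y ∈ Finset.Ici b, π y) * ∑ z, π z * X.resistance π b (max z y) ^ 2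
        ≤ X.trel * X.resistance π b y := by
    intro y
    refine (hπ.dirichlet_poincare hlazy hirr (f := fun z => X.resistance π b (max z y))
      fun x hx => X.resistance_of_le ((show (b : ℕ) ≤ x from hx).trans (le_max_left _ _))).trans ?_
    refine mul_le_mul_of_nonneg_left (le_of_eq ?_) (X.trel_pos hlazy).le
    rw [Finset.sum_eq_single y]
    · rcases lt_or_ge y b with h | h
      · rw [hπ.sum_P_mul_resistance hirr h, if_pos rfl, max_self]
        have := (hπ.pos hirr y).ne'
        field_simp
        ring
      · rw [max_self, X.resistance_of_le h, zero_mul, mul_zero]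
    · intro x _ hxy
      rcases lt_or_ge x b with h | h
      · rw [hπ.sum_P_mul_resistance hirr h, if_neg hxy]
        ring
      · rw [X.resistance_of_le ((show (b : ℕ) ≤ x from h).trans (le_max_left _ _)), zero_mul,
          mul_zero]
    · simp
  have h2 : (∑ y ∈ Finset.Ici b, π y) * ∑ y, π y * ∑ z, π z * X.resistance π b (max z y) ^ 2
      ≤ X.trel * X.meanHit π b 0 := by
    simp only [meanHit, greenOp, Nat.zero_le, max_eq_right, mul_one]
    rw [Finset.mul_sum, Finset.mul_sum]
    refine Finset.sum_le_sum fun y _ => ?_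
    calc _ = π y * ((∑ y ∈ Finset.Ici b, π y)
          * ∑ z, π z * X.resistance π b (max z y) ^ 2) := by ring
      _ ≤ π y * (X.trel * X.resistance π b y) := mul_le_mul_of_nonneg_left (h1 y) (hπ.nonneg y)
      _ = _ := by ring
  have h3 : 0 ≤ ∑ y ∈ Finset.Ici b, π y := Finset.sum_nonneg fun y _ => hπ.nonneg y
  rw [varHit_zero, mul_sub]
  linarith [mul_nonneg h3 (hπ.meanHit_nonneg b 0)]

/-- The bulk of the stationary distribution is crossed in time of order `t_rel`: apply the Poincaré
inequality to the mean hitting time of `b`, made constant to the left of `a`. -/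
theorem mul_meanHit_le_trel (hπ : X.IsStationary π) (hlazy : X.IsLazy) (hirr : X.IsIrreducible)
    {a b : Fin (n + 1)} (hab : a ≤ b) {ε : ℝ} (ha : ε ≤ ∑ y ∈ Finset.Iic a, π y)
    (hb : ε ≤ ∑ y ∈ Finset.Ici b, π y) : ε * X.meanHit π b a ≤ 2 * X.trel := by
  rcases eq_or_lt_of_le hab with rfl | hab
  · rw [X.meanHit_self, mul_zero]
    linarith [X.trel_pos hlazy]
  set M := X.meanHit π b a with hM
  let f : Fin (n + 1) → ℝ := fun x => X.meanHit π b (max (x : ℕ) a)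
  have hf0 : ∀ x, b ≤ x → f x = 0 := fun x hx =>
    X.greenOp_of_le _ ((show (b : ℕ) ≤ x from hx).trans (le_max_left _ _))
  have hfa : ∀ x, x ≤ a → f x = M := fun x hx => by
    simp only [f]
    rw [max_eq_right (show (x : ℕ) ≤ a from hx)]
  have hfM : ∀ x, f x ≤ M := fun x => hπ.meanHit_anti b (le_max_right _ _)
  have hM1 : 1 ≤ M := hπ.one_le_meanHit hirr hab
  have hstep : ∀ x, x < b → f x - ∑ z, X.P x z * f z
      = ∑ y, π y * if x = max a y then (π x)⁻¹ else 0 := by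
    intro x hx
    have h1 : ∀ x : Fin (n + 1), f x
        = ∑ y, π y * X.resistance π b (max (x : ℕ) ((max a y : Fin (n + 1)) : ℕ)) := by
      intro x
      simp only [f, meanHit, greenOp, mul_one, Fin.coe_max, max_assoc]
    have h2 : ∑ z, X.P x z * f z = ∑ y, π y
        * ∑ z, X.P x z * X.resistance π b (max (z : ℕ) ((max a y : Fin (n + 1)) : ℕ)) := by
      simp only [h1, Finset.mul_sum]
      rw [Finset.sum_comm]
      exact Finset.sum_congr rfl fun y _ => Finset.sum_congr rfl fun z _ => by ring
    rw [h2, h1 x, ← Finset.sum_sub_distrib]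
    refine Finset.sum_congr rfl fun y _ => ?_
    rw [hπ.sum_P_mul_resistance hirr hx]
    ring
  have hE : ∑ x, π x * (f x * (f x - ∑ z, X.P x z * f z)) ≤ M := by
    have h1 : ∀ x, π x * (f x * (f x - ∑ z, X.P x z * f z))
        ≤ ∑ y, M * π y * if x = max a y then 1 else 0 := by
      intro x
      rcases lt_or_ge x b with hx | hx
      · rw [hstep x hx, Finset.mul_sum, Finset.mul_sum]
        refine Finset.sum_le_sum fun y _ => ?_
        split_ifs
        · have := (hπ.pos hirr x).ne'
          rw [show π x * (f x * (π y * (π x)⁻¹)) = f x * π y by field_simp, mul_one]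
          exact mul_le_mul_of_nonneg_right (hfM x) (hπ.nonneg y)
        · simp
      · rw [hf0 x hx, zero_mul, mul_zero]
        refine Finset.sum_nonneg fun y _ => mul_nonneg (mul_nonneg (by linarith) (hπ.nonneg y)) ?_
        split_ifs <;> norm_num
    refine (Finset.sum_le_sum fun x _ => h1 x).trans ?_
    rw [Finset.sum_comm]
    simp only [← Finset.mul_sum, Finset.sum_ite_eq', Finset.mem_univ, if_true, mul_one,
      hπ.sum_eq_one, le_refl]
  have hV := hπ.poincare hlazy hirr f
  set m := ∑ y, π y * f y
  have h1 : (∑ y ∈ Finset.Iic a, π y) * (M - m) ^ 2 + (∑ y ∈ Finset.Ici b, π y) * m ^ 2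
      ≤ ∑ x, π x * (f x - m) ^ 2 := by
    have hdisj : Disjoint (Finset.Iic a) (Finset.Ici b) :=
      Finset.disjoint_left.2 fun y hy hy' => absurd
        ((Finset.mem_Ici.1 hy').trans (Finset.mem_Iic.1 hy)) (not_le.2 hab)
    have e1 : (∑ y ∈ Finset.Iic a, π y) * (M - m) ^ 2
        = ∑ y ∈ Finset.Iic a, π y * (f y - m) ^ 2 := by
      rw [Finset.sum_mul]
      refine Finset.sum_congr rfl fun y hy => ?_
      rw [hfa y (Finset.mem_Iic.1 hy)]
    have e2 : (∑ y ∈ Finset.Ici b, π y) * m ^ 2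
        = ∑ y ∈ Finset.Ici b, π y * (f y - m) ^ 2 := by
      rw [Finset.sum_mul]
      refine Finset.sum_congr rfl fun y hy => ?_
      rw [hf0 y (Finset.mem_Ici.1 hy), zero_sub, neg_sq]
    rw [e1, e2, ← Finset.sum_union hdisj]
    exact Finset.sum_le_sum_of_subset_of_nonneg (Finset.subset_univ _)
      fun y _ _ => mul_nonneg (hπ.nonneg y) (sq_nonneg _)
  have h2 := mul_le_mul_of_nonneg_left hE (X.trel_pos hlazy).le
  have h3 := mul_le_mul_of_nonneg_right ha (sq_nonneg (M - m))
  have h4 := mul_le_mul_of_nonneg_right hb (sq_nonneg m)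
  have h5 : ε * ((M - m) ^ 2 + m ^ 2) ≤ X.trel * M := by linarith
  by_cases hε : ε ≤ 0
  · nlinarith [X.trel_pos hlazy]
  · push Not at hε
    -- `(M - m)² + m² ≥ M² / 2`, whatever the mean `m` of `f` is
    have h6 : ε * (M ^ 2 / 2) ≤ X.trel * M :=
      (mul_le_mul_of_nonneg_left (by nlinarith [sq_nonneg (M - 2 * m)]) hε.le).trans h5
    have h7 : (ε * M) * M ≤ (2 * X.trel) * M := by linarith
    exact le_of_mul_le_mul_right h7 (by linarith)

end IsStationary

end BirthDeathChain

/-! ### Total-variation distance and the coupling of two lazy walkers -/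

theorem tvDist_nonneg {Ω : Type*} [Fintype Ω] (μ ν : Ω → ℝ) : 0 ≤ tvDist μ ν :=
  mul_nonneg (by norm_num) (Finset.sum_nonneg fun _ _ => abs_nonneg _)

theorem tvDist_self {Ω : Type*} [Fintype Ω] (μ : Ω → ℝ) : tvDist μ μ = 0 := by
  simp [tvDist]

/-- Joint convexity of the total-variation distance, in the form in which couplings use it. -/
theorem tvDist_le_sum {Ω ι : Type*} [Fintype Ω] (s : Finset ι) {w : ι → ℝ}
    (hw : ∀ i ∈ s, 0 ≤ w i) {μ ν : Ω → ℝ} (μ' ν' : ι → Ω → ℝ)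
    (h : ∀ z, μ z - ν z = ∑ i ∈ s, w i * (μ' i z - ν' i z)) :
    tvDist μ ν ≤ ∑ i ∈ s, w i * tvDist (μ' i) (ν' i) := by
  have h1 : ∑ i ∈ s, w i * tvDist (μ' i) (ν' i)
      = (1 / 2) * ∑ z, ∑ i ∈ s, w i * |μ' i z - ν' i z| := by
    rw [Finset.sum_comm, Finset.mul_sum]
    refine Finset.sum_congr rfl fun i _ => ?_
    rw [tvDist, ← Finset.mul_sum]
    ring
  rw [h1, tvDist]
  refine mul_le_mul_of_nonneg_left (Finset.sum_le_sum fun z _ => ?_) (by norm_num)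
  rw [h z]
  refine (Finset.abs_sum_le_sum_abs _ _).trans (Finset.sum_le_sum fun i hi => ?_)
  rw [abs_mul, abs_of_nonneg (hw i hi)]

theorem sum_sub_sum_le_tvDist {Ω : Type*} [Fintype Ω] [DecidableEq Ω] {μ ν : Ω → ℝ}
    (h : ∑ x, μ x = ∑ x, ν x) (s : Finset Ω) : ∑ x ∈ s, μ x - ∑ x ∈ s, ν x ≤ tvDist μ ν := by
  have h1 : ∑ x ∈ s, (μ x - ν x) ≤ ∑ x ∈ s, |μ x - ν x| :=
    Finset.sum_le_sum fun x _ => le_abs_self _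
  have h2 : ∑ x ∈ sᶜ, -(μ x - ν x) ≤ ∑ x ∈ sᶜ, |μ x - ν x| :=
    Finset.sum_le_sum fun x _ => neg_le_abs _
  have h3 := Finset.sum_add_sum_compl s fun x => |μ x - ν x|
  have h4 := Finset.sum_add_sum_compl s μ
  have h5 := Finset.sum_add_sum_compl s ν
  simp only [Finset.sum_neg_distrib, Finset.sum_sub_distrib] at h1 h2
  unfold tvDist
  linarith

theorem tvDist_le_one {Ω : Type*} [Fintype Ω] {μ ν : Ω → ℝ} (hμ : ∀ x, 0 ≤ μ x)
    (hν : ∀ x, 0 ≤ ν x) (hμ1 : ∑ x, μ x = 1) (hν1 : ∑ x, ν x = 1) : tvDist μ ν ≤ 1 := by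
  have : ∑ x, |μ x - ν x| ≤ ∑ x, (μ x + ν x) := Finset.sum_le_sum fun x _ =>
    abs_le.2 ⟨by linarith [hμ x, hν x], by linarith [hμ x, hν x]⟩
  rw [Finset.sum_add_distrib, hμ1, hν1] at this
  unfold tvDist
  linarith

namespace BirthDeathChain

variable {n : ℕ} (X : BirthDeathChain n)

theorem pow_mem (t : ℕ) : X.P ^ t ∈ Matrix.rowStochastic ℝ (Fin (n + 1)) :=
  Submonoid.pow_mem _ X.stochastic t

theorem pow_nonneg (t : ℕ) (x y : Fin (n + 1)) : 0 ≤ (X.P ^ t) x y := (X.pow_mem t).1 x y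

theorem sum_pow (t : ℕ) (x : Fin (n + 1)) : ∑ y, (X.P ^ t) x y = 1 :=
  Matrix.sum_row_of_mem_rowStochastic (X.pow_mem t) x

theorem pow_succ_apply (t : ℕ) (x z : Fin (n + 1)) :
    (X.P ^ (t + 1)) x z = ∑ y, X.P x y * (X.P ^ t) y z := by
  rw [pow_succ', Matrix.mul_apply]

theorem IsLazy.P_le_half {X : BirthDeathChain n} (hlazy : X.IsLazy) {x y : Fin (n + 1)}
    (h : x ≠ y) : X.P x y ≤ 1 / 2 := by
  have h1 := X.sum_P x
  rw [← Finset.add_sum_erase _ _ (Finset.mem_univ x)] at h1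
  have h2 : X.P x y ≤ ∑ z ∈ Finset.univ.erase x, X.P x z :=
    Finset.single_le_sum (fun z _ => X.P_nonneg x z)
      (Finset.mem_erase.2 ⟨h.symm, Finset.mem_univ y⟩)
  linarith [hlazy x]

/-- A lazy birth-and-death chain preserves monotonicity, so survival decreases towards `b`. -/
theorem surv_le_surv_zero (hlazy : X.IsLazy) {b x : Fin (n + 1)} (hx : x ≤ b) (t : ℕ) :
    X.surv b t x ≤ X.surv b t 0 := by
  -- the survival probability as a function on `ℕ`, constant beyond `n`, where `up` vanishes
  let F : ℕ → ℕ → ℝ := fun t k => X.surv b t ⟨min k n, by lia⟩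
  have hF : ∀ (t : ℕ) (x : Fin (n + 1)), F t x = X.surv b t x :=
    fun t x => congrArg (X.surv b t) (Fin.ext (by simp; lia))
  have hstep : ∀ t (k : ℕ), k < b → F (t + 1) k
      = F t k + X.up k * (F t (k + 1) - F t k) + X.dn k * (F t (k - 1) - F t k) := by
    intro t k hk
    have h := X.sum_P_mul (F t) ⟨k, by lia⟩
    simp only [hF] at h
    rw [← X.surv_succ (Fin.ne_of_lt (show (⟨k, by lia⟩ : Fin (n + 1)) < b from hk))] at h
    simp only [← hF] at h
    exact h
  have hup : ∀ k, X.up k ≤ 1 / 2 := by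
    intro k
    unfold up
    split_ifs
    · exact hlazy.P_le_half (by simp)
    · norm_num
  have hdn : ∀ k, X.dn k ≤ 1 / 2 := by
    intro k
    unfold dn
    split_ifs
    · exact hlazy.P_le_half (fun h => by simp at h; lia)
    · norm_num
  have key : ∀ t (k : ℕ), k + 1 ≤ b → F t (k + 1) ≤ F t k := by
    intro t
    induction t with
    | zero =>
      intro k hk
      have h1 : F 0 k = 1 := X.surv_zero fun h => by
        have := congrArg Fin.val h
        simp at this
        lia
      rw [h1]
      simp only [F, surv]
      split_ifs <;> norm_num
    | succ t ih =>
      intro k hk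
      rcases Nat.lt_or_eq_of_le hk with hk' | hk'
      · rw [hstep t k (by lia), hstep t (k + 1) hk', Nat.add_sub_cancel]
        have h1 := ih k hk
        have h2 := ih (k + 1) hk'
        have h3 : F t k ≤ F t (k - 1) := by
          rcases Nat.eq_zero_or_pos k with rfl | hk0
          · simp
          · have := ih (k - 1) (by lia)
            rwa [show k - 1 + 1 = k by lia] at this
        have h4 := mul_le_mul_of_nonneg_right (hup k) (sub_nonneg.2 h1)
        have h5 := mul_le_mul_of_nonneg_right (hdn (k + 1)) (sub_nonneg.2 h1)
        have h6 := mul_nonneg (X.up_nonneg (k + 1)) (sub_nonneg.2 h2)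
        have h7 := mul_nonneg (X.dn_nonneg k) (sub_nonneg.2 h3)
        linarith
      · rw [hk', hF, X.surv_self]
        exact X.surv_nonneg b _ _
  have h : ∀ k : ℕ, k ≤ b → F t k ≤ F t 0 := by
    intro k
    induction k with
    | zero => exact fun _ => le_rfl
    | succ k ih => exact fun hk => (key t k hk).trans (ih (by lia))
  have h1 := h x hx
  rw [hF] at h1
  exact h1

/-- The entries of `P - I / 2`, which are nonnegative for a lazy chain: half the transition matrix
of the chain without its laziness. -/
def halfStep (x y : Fin (n + 1)) : ℝ := X.P x y - if x = y then 1 / 2 else 0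

theorem IsLazy.halfStep_nonneg {X : BirthDeathChain n} (hlazy : X.IsLazy) (x y : Fin (n + 1)) :
    0 ≤ X.halfStep x y := by
  unfold halfStep
  split_ifs with h
  · subst h
    linarith [hlazy x]
  · linarith [X.P_nonneg x y]

theorem sum_halfStep_mul (x : Fin (n + 1)) (f : Fin (n + 1) → ℝ) :
    ∑ y, X.halfStep x y * f y = ∑ y, X.P x y * f y - 1 / 2 * f x := by
  simp only [halfStep, sub_mul, Finset.sum_sub_distrib, ite_mul, zero_mul, Finset.sum_ite_eq,
    Finset.mem_univ, if_true]

/-- The coupling in which a fair coin decides which of the two walkers moves. -/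
theorem tvDist_pow_succ_le (hlazy : X.IsLazy) (t : ℕ) (x y : Fin (n + 1)) :
    tvDist ((X.P ^ (t + 1)) x) ((X.P ^ (t + 1)) y)
      ≤ ∑ x', X.halfStep x x' * tvDist ((X.P ^ t) x') ((X.P ^ t) y)
        + ∑ y', X.halfStep y y' * tvDist ((X.P ^ t) x) ((X.P ^ t) y') := by
  have h := tvDist_le_sum (Finset.univ : Finset (Fin (n + 1) ⊕ Fin (n + 1)))
    (w := Sum.elim (X.halfStep x) (X.halfStep y))
    (μ := (X.P ^ (t + 1)) x) (ν := (X.P ^ (t + 1)) y)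
    (by rintro (i | i) - <;> exact hlazy.halfStep_nonneg _ _)
    (Sum.elim (fun x' => (X.P ^ t) x') (fun _ => (X.P ^ t) x))
    (Sum.elim (fun _ => (X.P ^ t) y) (fun y' => (X.P ^ t) y'))
    (by
      intro z
      rw [Fintype.sum_sum_type]
      simp only [Sum.elim_inl, Sum.elim_inr]
      rw [X.sum_halfStep_mul x (fun x' => (X.P ^ t) x' z - (X.P ^ t) y z),
        X.sum_halfStep_mul y (fun y' => (X.P ^ t) x z - (X.P ^ t) y' z)]
      simp only [mul_sub, Finset.sum_sub_distrib, ← Finset.sum_mul, X.sum_P,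
        ← X.pow_succ_apply]
      ring)
  rw [Fintype.sum_sum_type] at h
  exact h

/-- A walker from `x` and a stationary walker started to its right: as long as they have not met,
either the first has not yet reached `b`, or the second was to the right of `b` when it did. -/
theorem IsStationary.sum_tvDist_right_le {X : BirthDeathChain n} {π : Fin (n + 1) → ℝ}
    (hπ : X.IsStationary π) (hlazy : X.IsLazy) (b : Fin (n + 1)) (t : ℕ) (x : Fin (n + 1)) :
    ∑ y, π y * (if x < y then tvDist ((X.P ^ t) x) ((X.P ^ t) y) else 0)
      ≤ ∑ y ∈ Finset.Ioi b, π y + X.surv b t 0 := by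
  let L : ℕ → Fin (n + 1) → Fin (n + 1) → ℝ := fun t x y =>
    if x < y then tvDist ((X.P ^ t) x) ((X.P ^ t) y) else 0
  have hL0 : ∀ t x y, 0 ≤ L t x y := by
    intro t x y
    simp only [L]
    split_ifs
    · exact tvDist_nonneg _ _
    · exact le_rfl
  -- walkers that only move to adjacent states, one at a time, meet before they cross
  have hL : ∀ t x y, L (t + 1) x y
      ≤ ∑ x', X.halfStep x x' * L t x' y + ∑ y', X.halfStep y y' * L t x y' := by
    intro t x y
    by_cases hxy : x < y
    · have hxy' : (x : ℕ) < y := hxy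
      have h1 : ∀ u v : Fin (n + 1), (u : ℕ) ≤ v →
          tvDist ((X.P ^ t) u) ((X.P ^ t) v) ≤ L t u v := by
        intro u v huv
        simp only [L]
        split_ifs with h
        · exact le_rfl
        · rw [show u = v from Fin.ext (le_antisymm huv (not_lt.1 h)), tvDist_self]
      simp only [L, if_pos hxy]
      refine (X.tvDist_pow_succ_le hlazy t x y).trans (add_le_add ?_ ?_)
      · refine Finset.sum_le_sum fun x' _ => ?_
        by_cases hx' : (x : ℕ) + 1 < x'
        · have h2 : X.halfStep x x' = 0 := by
            rw [halfStep, X.P_eq_zero (Or.inl hx'), if_neg (by rintro rfl; lia), sub_zero]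
          rw [h2, zero_mul, zero_mul]
        · exact mul_le_mul_of_nonneg_left (h1 x' y (by lia)) (hlazy.halfStep_nonneg _ _)
      · refine Finset.sum_le_sum fun y' _ => ?_
        by_cases hy' : (y' : ℕ) + 1 < y
        · have h2 : X.halfStep y y' = 0 := by
            rw [halfStep, X.P_eq_zero (Or.inr hy'), if_neg (by rintro rfl; lia), sub_zero]
          rw [h2, zero_mul, zero_mul]
        · exact mul_le_mul_of_nonneg_left (h1 x y' (by lia)) (hlazy.halfStep_nonneg _ _)
    · simp only [L, if_neg hxy]
      exact add_nonneg
        (Finset.sum_nonneg fun z _ => mul_nonneg (hlazy.halfStep_nonneg _ _) (hL0 t z y))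
        (Finset.sum_nonneg fun z _ => mul_nonneg (hlazy.halfStep_nonneg _ _) (hL0 t x z))
  let W : ℕ → Fin (n + 1) → ℝ := fun t x => ∑ y, π y * L t x y
  have hW : ∀ t x, W (t + 1) x ≤ ∑ x', X.P x x' * W t x' := by
    intro t x
    have h1 : W (t + 1) x ≤ ∑ y, π y * ∑ x', X.halfStep x x' * L t x' y
        + ∑ y, π y * ∑ y', X.halfStep y y' * L t x y' := by
      rw [← Finset.sum_add_distrib]
      refine Finset.sum_le_sum fun y _ => ?_
      rw [← mul_add]
      exact mul_le_mul_of_nonneg_left (hL t x y) (hπ.nonneg y)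
    have h2 : ∑ y, π y * ∑ x', X.halfStep x x' * L t x' y
        = ∑ x', X.P x x' * W t x' - 1 / 2 * W t x := by
      rw [← X.sum_halfStep_mul x (W t)]
      simp only [W, Finset.mul_sum]
      rw [Finset.sum_comm]
      exact Finset.sum_congr rfl fun y _ => Finset.sum_congr rfl fun z _ => by ring
    have h3 : ∑ y, π y * ∑ y', X.halfStep y y' * L t x y' = 1 / 2 * W t x := by
      simp only [X.sum_halfStep_mul, mul_sub, Finset.sum_sub_distrib, hπ.sum_mul_sum_P]
      have : ∑ y, π y * (1 / 2 * L t x y) = 1 / 2 * W t x := by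
        rw [Finset.mul_sum]
        exact Finset.sum_congr rfl fun y _ => by ring
      rw [this]
      simp only [W]
      ring
    linarith
  have hWle : ∀ t x, b ≤ x → W t x ≤ ∑ y ∈ Finset.Ioi b, π y := by
    intro t x hx
    refine le_trans ?_ (Finset.sum_le_sum_of_subset_of_nonneg (Finset.Ioi_subset_Ioi hx)
      fun y _ _ => hπ.nonneg y)
    refine le_trans (le_of_eq ?_) (Finset.sum_le_sum (s := Finset.Ioi x)
      (f := fun y => π y * L t x y) fun y _ => ?_)
    · refine (Finset.sum_subset (Finset.subset_univ _) fun y _ hy => ?_).symm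
      simp only [L]
      rw [if_neg fun h => hy (Finset.mem_Ioi.2 h), mul_zero]
    · refine mul_le_of_le_one_right (hπ.nonneg y) ?_
      simp only [L]
      split_ifs
      · exact tvDist_le_one (X.pow_nonneg t x) (X.pow_nonneg t y) (X.sum_pow t x) (X.sum_pow t y)
      · exact zero_le_one
  have hWsurv : ∀ t, ∀ x ≤ b, W t x ≤ ∑ y ∈ Finset.Ioi b, π y + X.surv b t x := by
    intro t
    induction t with
    | zero =>
      intro x hx
      rcases eq_or_lt_of_le hx with rfl | hx
      · rw [X.surv_self, add_zero]
        exact hWle 0 _ le_rfl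
      · rw [X.surv_zero hx.ne]
        have h1 : W 0 x ≤ ∑ y, π y := by
          refine Finset.sum_le_sum fun y _ => mul_le_of_le_one_right (hπ.nonneg y) ?_
          simp only [L]
          split_ifs
          · exact tvDist_le_one (X.pow_nonneg 0 x) (X.pow_nonneg 0 y) (X.sum_pow 0 x)
              (X.sum_pow 0 y)
          · exact zero_le_one
        rw [hπ.sum_eq_one] at h1
        linarith [Finset.sum_nonneg fun y (_ : y ∈ Finset.Ioi b) => hπ.nonneg y]
    | succ t ih =>
      intro x hx
      rcases eq_or_lt_of_le hx with rfl | hx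
      · rw [X.surv_self, add_zero]
        exact hWle _ _ le_rfl
      · refine (hW t x).trans ((X.sum_P_mul_mono hx ih).trans (le_of_eq ?_))
        simp only [mul_add, Finset.sum_add_distrib, ← Finset.sum_mul, X.sum_P, one_mul,
          X.surv_succ hx.ne]
  rcases le_total x b with hx | hx
  · exact (hWsurv t x hx).trans (by linarith [X.surv_le_surv_zero hlazy hx t])
  · exact (hWle t x hx).trans (by linarith [X.surv_nonneg b t 0])

/-- A walker that has not reached `a` is still to the left of `a`. -/
theorem surv_le_sum_pow (a : Fin (n + 1)) (t : ℕ) :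
    ∀ x ≤ a, X.surv a t x ≤ ∑ y ∈ Finset.Iio a, (X.P ^ t) x y := by
  induction t with
  | zero =>
    intro x hx
    rcases eq_or_lt_of_le hx with rfl | hx
    · rw [X.surv_self]
      exact Finset.sum_nonneg fun y _ => X.pow_nonneg _ _ _
    · rw [X.surv_zero hx.ne]
      refine le_trans (le_of_eq ?_) (Finset.single_le_sum (fun y _ => X.pow_nonneg _ _ _)
        (Finset.mem_Iio.2 hx))
      simp
  | succ t ih =>
    intro x hx
    rcases eq_or_lt_of_le hx with rfl | hx
    · rw [X.surv_self]
      exact Finset.sum_nonneg fun y _ => X.pow_nonneg _ _ _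
    · rw [X.surv_succ hx.ne]
      refine (X.sum_P_mul_mono hx ih).trans (le_of_eq ?_)
      simp only [X.pow_succ_apply, Finset.mul_sum]
      exact Finset.sum_comm

theorem le_worstDist (π : Fin (n + 1) → ℝ) (t : ℕ) (x : Fin (n + 1)) :
    tvDist ((X.P ^ t) x) π ≤ X.worstDist π t :=
  le_ciSup (f := fun x => tvDist ((X.P ^ t) x) π) (Set.finite_range _).bddAbove x

theorem worstDist_le {π : Fin (n + 1) → ℝ} {t : ℕ} {δ : ℝ}
    (h : ∀ x, tvDist ((X.P ^ t) x) π ≤ δ) : X.worstDist π t ≤ δ :=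
  ciSup_le h

theorem tmix_le {π : Fin (n + 1) → ℝ} {t : ℕ} {δ : ℝ} (h : X.worstDist π t ≤ δ) :
    X.tmix π δ ≤ t :=
  Nat.sInf_le h

theorem worstDist_tmix_le {π : Fin (n + 1) → ℝ} {t : ℕ} {δ : ℝ} (h : X.worstDist π t ≤ δ) :
    X.worstDist π (X.tmix π δ) ≤ δ :=
  Nat.sInf_mem (s := {t | X.worstDist π t ≤ δ}) ⟨t, h⟩

/-- The lower bound on the mixing time: test the distance on the states to the left of `a`. -/
theorem IsStationary.surv_le_worstDist {X : BirthDeathChain n} {π : Fin (n + 1) → ℝ}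
    (hπ : X.IsStationary π) (a : Fin (n + 1)) (t : ℕ) :
    X.surv a t 0 ≤ X.worstDist π t + ∑ y ∈ Finset.Iio a, π y := by
  have h1 := X.surv_le_sum_pow a t 0 (Fin.zero_le a)
  have h2 := sum_sub_sum_le_tvDist (μ := (X.P ^ t) 0) (ν := π)
    ((X.sum_pow t 0).trans hπ.sum_eq_one.symm) (Finset.Iio a)
  have h3 := X.le_worstDist π t 0
  linarith

/-! ### Reflection of the state space -/

/-- The mirror image of the chain under `x ↦ n - x`. -/
def mirror : BirthDeathChain n where
  P := fun x y => X.P x.rev y.rev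
  stochastic := by
    refine Matrix.mem_rowStochastic_iff_sum.2 ⟨fun x y => X.P_nonneg _ _, fun x => ?_⟩
    rw [← X.sum_P x.rev]
    exact Equiv.sum_comp Fin.revPerm (fun y => X.P x.rev y)
  adjacent := fun x y h => by
    have := X.adjacent _ _ h
    rw [Fin.val_rev, Fin.val_rev] at this
    rw [abs_le] at this ⊢
    lia

theorem mirror_pow (t : ℕ) (x y : Fin (n + 1)) :
    (X.mirror.P ^ t) x y = (X.P ^ t) x.rev y.rev := by
  induction t generalizing x with
  | zero => simp [Matrix.one_apply]
  | succ t ih =>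
    rw [pow_succ_apply, pow_succ_apply]
    simp only [ih]
    exact Equiv.sum_comp Fin.revPerm (fun z => X.P x.rev z * (X.P ^ t) z y.rev)

theorem IsLazy.mirror {X : BirthDeathChain n} (h : X.IsLazy) : X.mirror.IsLazy := fun x => h x.rev

theorem IsIrreducible.mirror {X : BirthDeathChain n} (h : X.IsIrreducible) :
    X.mirror.IsIrreducible := by
  refine (Matrix.isIrreducible_iff_exists_pow_pos X.mirror.P_nonneg).2 fun x y => ?_
  obtain ⟨k, hk, hpos⟩ := (Matrix.isIrreducible_iff_exists_pow_pos X.P_nonneg).1 h x.rev y.rev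
  exact ⟨k, hk, by rwa [mirror_pow]⟩

theorem IsStationary.mirror {X : BirthDeathChain n} {π : Fin (n + 1) → ℝ}
    (h : X.IsStationary π) : X.mirror.IsStationary (fun x => π x.rev) where
  nonneg _ := h.nonneg _
  sum_eq_one := (Equiv.sum_comp Fin.revPerm π).trans h.sum_eq_one
  invariant := funext fun y =>
    (Equiv.sum_comp Fin.revPerm (fun x => π x * X.P x y.rev)).trans (h.sum_mul_P y.rev)

theorem mirror_surv (y : Fin (n + 1)) (t : ℕ) (x : Fin (n + 1)) :
    X.mirror.surv y t x = X.surv y.rev t x.rev := by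
  induction t generalizing x with
  | zero => simp [surv]
  | succ t ih =>
    simp only [surv, Fin.rev_inj, ih]
    congr 1
    exact Equiv.sum_comp Fin.revPerm (fun z => X.P x.rev z * X.surv y.rev t z)

theorem mirror_expHit (x y : Fin (n + 1)) : X.mirror.expHit x y = X.expHit x.rev y.rev := by
  simp only [expHit_eq_tsum, mirror_surv]

theorem mirror_tvDist (t : ℕ) (x : Fin (n + 1)) (μ : Fin (n + 1) → ℝ) :
    tvDist ((X.mirror.P ^ t) x) (fun y => μ y.rev) = tvDist ((X.P ^ t) x.rev) μ := by
  unfold tvDist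
  simp only [mirror_pow]
  congr 1
  exact Equiv.sum_comp Fin.revPerm (fun z => |(X.P ^ t) x.rev z - μ z|)

theorem mirror_worstDist (π : Fin (n + 1) → ℝ) (t : ℕ) :
    X.mirror.worstDist (fun x => π x.rev) t = X.worstDist π t := by
  unfold worstDist
  simp only [mirror_tvDist]
  exact Equiv.iSup_comp (g := fun x => tvDist ((X.P ^ t) x) π) Fin.revPerm

theorem mirror_tmix (π : Fin (n + 1) → ℝ) (δ : ℝ) :
    X.mirror.tmix (fun x => π x.rev) δ = X.tmix π δ := by
  simp only [tmix, mirror_worstDist]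

theorem hasEigenvalue_iff {μ : ℝ} : Module.End.HasEigenvalue (Matrix.toLin' X.P) μ
    ↔ ∃ f : Fin (n + 1) → ℝ, f ≠ 0 ∧ ∀ x, ∑ y, X.P x y * f y = μ * f x :=
  ⟨X.exists_eigenfunction, fun ⟨_, h0, h⟩ => X.hasEigenvalue_of_eigenfunction h0 h⟩

theorem mirror_hasEigenvalue {μ : ℝ} : Module.End.HasEigenvalue (Matrix.toLin' X.mirror.P) μ
    ↔ Module.End.HasEigenvalue (Matrix.toLin' X.P) μ := by
  rw [hasEigenvalue_iff, hasEigenvalue_iff]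
  constructor
  · rintro ⟨f, h0, h⟩
    refine ⟨fun x => f x.rev, fun hf => h0 (funext fun x => ?_), fun x => ?_⟩
    · simpa using congrFun hf x.rev
    · rw [← h x.rev]
      simpa [mirror] using
        (Equiv.sum_comp Fin.revPerm (fun y => X.P x y * f y.rev)).symm
  · rintro ⟨f, h0, h⟩
    refine ⟨fun x => f x.rev, fun hf => h0 (funext fun x => ?_), fun x => ?_⟩
    · simpa using congrFun hf x.rev
    · rw [← h x.rev]
      exact Equiv.sum_comp Fin.revPerm (fun y => X.P x.rev y * f y)

theorem mirror_trel : X.mirror.trel = X.trel := by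
  simp only [trel, gap, lambdaStar, mirror_hasEigenvalue]

theorem sum_rev_eq (π : Fin (n + 1) → ℝ) {s s' : Finset (Fin (n + 1))}
    (h : ∀ y, y ∈ s ↔ y.rev ∈ s') : ∑ y ∈ s, π y.rev = ∑ y ∈ s', π y :=
  Finset.sum_equiv Fin.revPerm h fun _ _ => rfl

/-- The worst-case distance is controlled by the time to sweep across the state space from either
end. -/
theorem IsStationary.worstDist_le_surv {X : BirthDeathChain n} {π : Fin (n + 1) → ℝ}
    (hπ : X.IsStationary π) (hlazy : X.IsLazy) (a b : Fin (n + 1)) (t : ℕ) :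
    X.worstDist π t ≤ (∑ y ∈ Finset.Ioi b, π y + X.surv b t 0)
      + (∑ y ∈ Finset.Iio a, π y + X.surv a t (Fin.last n)) := by
  refine X.worstDist_le fun x => ?_
  have h1 : tvDist ((X.P ^ t) x) π ≤ ∑ y, π y * tvDist ((X.P ^ t) x) ((X.P ^ t) y) := by
    refine tvDist_le_sum Finset.univ (fun y _ => hπ.nonneg y) (fun _ => (X.P ^ t) x)
      (fun y => (X.P ^ t) y) fun z => ?_
    simp only [mul_sub, Finset.sum_sub_distrib, ← Finset.sum_mul, hπ.sum_eq_one, one_mul,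
      hπ.sum_mul_pow]
  have h2 := hπ.sum_tvDist_right_le hlazy b t x
  have h3 := hπ.mirror.sum_tvDist_right_le hlazy.mirror a.rev t x.rev
  have h4 : ∑ y : Fin (n + 1), π y.rev * (if x.rev < y then
        tvDist ((X.mirror.P ^ t) x.rev) ((X.mirror.P ^ t) y) else 0)
      = ∑ y, π y * (if y < x then tvDist ((X.P ^ t) x) ((X.P ^ t) y) else 0) := by
    rw [← Equiv.sum_comp Fin.revPerm (fun y =>
      π y * (if y < x then tvDist ((X.P ^ t) x) ((X.P ^ t) y) else 0))]
    refine Finset.sum_congr rfl fun y _ => ?_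
    have h5 : (X.mirror.P ^ t) y = fun z => (X.P ^ t) y.rev z.rev :=
      funext fun z => X.mirror_pow t y z
    simp only [Fin.revPerm_apply, h5, mirror_tvDist, Fin.rev_rev, Fin.rev_lt_iff]
  rw [h4, mirror_surv, Fin.rev_rev, Fin.rev_zero,
    sum_rev_eq π (s' := Finset.Iio a) fun y => by simp [Fin.rev_lt_iff]] at h3
  refine h1.trans (le_trans ?_ (add_le_add h2 h3))
  rw [← Finset.sum_add_distrib]
  refine Finset.sum_le_sum fun y _ => ?_
  rw [← mul_add]
  refine mul_le_mul_of_nonneg_left ?_ (hπ.nonneg y)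
  rcases lt_trichotomy x y with h | rfl | h
  · rw [if_pos h, if_neg h.not_gt, add_zero]
  · rw [tvDist_self]
    simp
  · rw [if_pos h, if_neg h.not_gt, zero_add]

end BirthDeathChain

/-! ### Location of the cutoff -/

namespace BirthDeathChain

variable {n : ℕ} {X : BirthDeathChain n} {π : Fin (n + 1) → ℝ}

theorem IsStationary.expHit_zero (hπ : X.IsStationary π) (hirr : X.IsIrreducible)
    (b : Fin (n + 1)) :
    X.expHit 0 b ≠ ∞ ∧ (X.expHit 0 b).toReal = X.meanHit π b 0 := by
  rw [hπ.expHit_eq hirr (Fin.zero_le b)]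
  exact ⟨ENNReal.ofReal_ne_top, ENNReal.toReal_ofReal (hπ.meanHit_nonneg _ _)⟩

theorem IsStationary.markov_left (hπ : X.IsStationary π) (hirr : X.IsIrreducible)
    (b : Fin (n + 1)) (t : ℕ) : (t + 1) * X.surv b t 0 ≤ (X.expHit 0 b).toReal := by
  have h := hπ.add_mul_surv_le hirr b t 0 le_rfl 0 (Fin.zero_le b)
  rw [zero_add, add_zero] at h
  rwa [(hπ.expHit_zero hirr b).2]

/-- Chebyshev's inequality for the upper tail of `τ_b` from `0`. -/
theorem IsStationary.chebyshev_left (hπ : X.IsStationary π) (hlazy : X.IsLazy)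
    (hirr : X.IsIrreducible) {b : Fin (n + 1)} {ε : ℝ} (hε : 0 ≤ ε)
    (hb : ε ≤ ∑ y ∈ Finset.Ici b, π y) {t : ℕ} (ht : (X.expHit 0 b).toReal ≤ t + 1) :
    ε * (X.surv b t 0 * (t + 1 - (X.expHit 0 b).toReal) ^ 2)
      ≤ X.trel * (X.expHit 0 b).toReal := by
  rw [(hπ.expHit_zero hirr b).2] at ht ⊢
  have h1 := hπ.surv_mul_sq_le hirr b t (-X.meanHit π b 0) (by linarith) 0 (Fin.zero_le b)
  have h2 := hπ.varHit_le hlazy hirr b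
  have h3 := hπ.varHit_nonneg hirr 0 (Fin.zero_le b)
  simp only [Fin.val_zero, add_neg_cancel, zero_pow two_ne_zero, add_zero] at h1 h3
  rw [show -X.meanHit π b 0 + t + 1 = t + 1 - X.meanHit π b 0 by ring] at h1
  exact (mul_le_mul_of_nonneg_left h1 hε).trans ((mul_le_mul_of_nonneg_right hb h3).trans h2)

theorem IsStationary.markov_right (hπ : X.IsStationary π) (hirr : X.IsIrreducible)
    (a : Fin (n + 1)) (t : ℕ) :
    (t + 1) * X.surv a t (Fin.last n) ≤ (X.expHit (Fin.last n) a).toReal := by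
  have h := hπ.mirror.markov_left hirr.mirror a.rev t
  rwa [mirror_surv, mirror_expHit, Fin.rev_rev, Fin.rev_zero] at h

theorem IsStationary.chebyshev_right (hπ : X.IsStationary π) (hlazy : X.IsLazy)
    (hirr : X.IsIrreducible) {a : Fin (n + 1)} {ε : ℝ} (hε : 0 ≤ ε)
    (ha : ε ≤ ∑ y ∈ Finset.Iic a, π y) {t : ℕ} (ht : (X.expHit (Fin.last n) a).toReal ≤ t + 1) :
    ε * (X.surv a t (Fin.last n) * (t + 1 - (X.expHit (Fin.last n) a).toReal) ^ 2)
      ≤ X.trel * (X.expHit (Fin.last n) a).toReal := by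
  have h := hπ.mirror.chebyshev_left hlazy.mirror hirr.mirror (b := a.rev) hε (t := t)
  rw [mirror_surv, mirror_expHit, mirror_trel, Fin.rev_rev, Fin.rev_zero,
    sum_rev_eq π (s' := Finset.Iic a) fun y => by simp [Fin.rev_le_iff]] at h
  exact h ha ht

/-- The location of the cutoff, for a chain that takes longer to sweep from the left than from the
right. The states `a` and `b` are only required to have the tail masses of the `ε`- and
`(1 - ε)`-quantiles, so that the statement is invariant under reflection, and `m` is any state
between them. -/
theorem IsStationary.cutoff_location (hπ : X.IsStationary π) (hlazy : X.IsLazy)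
    (hirr : X.IsIrreducible) {a m b : Fin (n + 1)} (ham : a ≤ m) (hmb : m ≤ b)
    {ε : ℝ} (hε0 : 0 < ε) (hε1 : ε < 1 / 16)
    (ha : ε ≤ ∑ y ∈ Finset.Iic a, π y) (ha' : ∑ y ∈ Finset.Iio a, π y ≤ ε)
    (hb : ε ≤ ∑ y ∈ Finset.Ici b, π y) (hb' : ∑ y ∈ Finset.Ioi b, π y ≤ ε)
    (hrel : X.trel < ε ^ 5 * (X.tmix π (1 / 4) : ℝ))
    (hle : X.expHit (Fin.last n) a ≤ X.expHit 0 b) :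
    X.expHit 0 m ≠ ∞ ∧
    (X.expHit 0 m).toReal - (2 / ε) * √(X.trel * (X.expHit 0 m).toReal)
      ≤ (X.tmix π (1 - 2 * ε) : ℝ) ∧
    (X.tmix π (4 * ε) : ℝ)
      ≤ (X.expHit 0 m).toReal + (3 / ε) * √(X.trel * (X.expHit 0 m).toReal) ∧
    (X.expHit 0 m).toReal ≤ 4 / 3 * (X.tmix π (1 / 4) : ℝ) := by
  obtain ⟨hHtop, hH⟩ := hπ.expHit_zero hirr b
  obtain ⟨hhtop, hh⟩ := hπ.expHit_zero hirr m
  have hH'H := ENNReal.toReal_mono hHtop hle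
  have hTpos := X.trel_pos hlazy
  have hadd_b : X.meanHit π b 0 = X.meanHit π m 0 + X.meanHit π b m :=
    X.meanHit_zero_add (show (m : ℕ) ≤ b from hmb)
  have hadd_m : X.meanHit π m 0 = X.meanHit π a 0 + X.meanHit π m a :=
    X.meanHit_zero_add (show (a : ℕ) ≤ m from ham)
  have hadd_ab : X.meanHit π b 0 = X.meanHit π a 0 + X.meanHit π b a :=
    X.meanHit_zero_add (show (a : ℕ) ≤ b from ham.trans hmb)
  have hbm := hπ.meanHit_anti b (show (a : ℕ) ≤ m from ham)
  have hbm0 := hπ.meanHit_nonneg b m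
  have hma0 := hπ.meanHit_nonneg m a
  have hA0 := hπ.meanHit_nonneg a 0
  have hM := hπ.mul_meanHit_le_trel hlazy hirr (ham.trans hmb) ha hb
  have hM0 := hπ.meanHit_nonneg b a
  have hmarkL := hπ.markov_left hirr b
  have hmarkR := hπ.markov_right hirr a
  have hchebL := fun t => hπ.chebyshev_left hlazy hirr hε0.le hb (t := t)
  have hchebR := fun t => hπ.chebyshev_right hlazy hirr hε0.le ha (t := t)
  have hdist : ∀ t, X.worstDist π t
      ≤ 2 * ε + X.surv b t 0 + X.surv a t (Fin.last n) := fun t => by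
    linarith [hπ.worstDist_le_surv hlazy a b t]
  rw [hH] at hH'H hmarkL hchebL
  rw [hh]
  refine ⟨hhtop, ?_⟩
  set T := X.trel
  set H := X.meanHit π b 0
  set h := X.meanHit π m 0
  set M := X.meanHit π b a
  set H' := (X.expHit (Fin.last n) a).toReal
  have hHpos0 : 0 ≤ H := by linarith
  -- Markov's inequality shows `t_mix(1/4) ≤ 16 H`, so that `t_rel` is much smaller than `H`
  have hmix : (X.tmix π (1 / 4) : ℝ) ≤ 16 * H := by
    have ht : 16 * H < ⌊16 * H⌋₊ + 1 := Nat.lt_floor_add_one _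
    have ht' : (⌊16 * H⌋₊ : ℝ) ≤ 16 * H := Nat.floor_le (by linarith)
    set t := ⌊16 * H⌋₊
    have ht0 : (0 : ℝ) < t + 1 := by positivity
    have h1 : X.surv b t 0 ≤ 1 / 16 := by
      refine le_of_mul_le_mul_left ?_ ht0
      linarith [hmarkL t]
    have h2 : X.surv a t (Fin.last n) ≤ 1 / 16 := by
      refine le_of_mul_le_mul_left ?_ ht0
      linarith [hmarkR t]
    have h3 : X.tmix π (1 / 4) ≤ t := X.tmix_le (by linarith [hdist t])
    have h4 : (X.tmix π (1 / 4) : ℝ) ≤ t := by exact_mod_cast h3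
    linarith
  have hTH : T ≤ ε ^ 4 * H := by
    have h1 : ε ^ 5 * (X.tmix π (1 / 4) : ℝ) ≤ ε ^ 5 * (16 * H) :=
      mul_le_mul_of_nonneg_left hmix (by positivity)
    have h2 : 16 * ε * (ε ^ 4 * H) ≤ 1 * (ε ^ 4 * H) :=
      mul_le_mul_of_nonneg_right (by linarith) (by positivity)
    have h3 : ε ^ 5 * (16 * H) = 16 * ε * (ε ^ 4 * H) := by ring
    linarith
  have hMH : M ≤ H / 2 := by
    have h1 : ε * M ≤ ε * (2 * ε ^ 3 * H) := by
      refine hM.trans ?_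
      have : ε * (2 * ε ^ 3 * H) = 2 * (ε ^ 4 * H) := by ring
      linarith
    have h2 := le_of_mul_le_mul_left h1 hε0
    have h3 : ε ^ 3 ≤ (1 / 16) ^ 3 := pow_le_pow_left₀ hε0.le hε1.le 3
    have h4 := mul_le_mul_of_nonneg_right h3 hHpos0
    norm_num at h4
    linarith
  have hHh : H ≤ 2 * h := by linarith
  have hhpos : 0 < h := by
    have : 0 < ε ^ 4 * H := hTpos.trans_le hTH
    have : 0 < H := (mul_pos_iff_of_pos_left (by positivity)).1 this
    linarith
  set s := √(T * h)
  have hs0 : 0 < s := Real.sqrt_pos.2 (mul_pos hTpos hhpos)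
  have hs2 : s ^ 2 = T * h := Real.sq_sqrt (mul_pos hTpos hhpos).le
  have hTh : T ≤ 2 * ε ^ 4 * h := by
    have := mul_le_mul_of_nonneg_left hHh (show 0 ≤ ε ^ 4 by positivity)
    linarith
  have hTs : T ≤ 2 * ε ^ 2 * s := by
    refine le_of_sq_le_sq ?_ (by positivity)
    calc T ^ 2 = T * T := sq T
      _ ≤ T * (2 * ε ^ 4 * h) := mul_le_mul_of_nonneg_left hTh hTpos.le
      _ = 2 * ε ^ 4 * s ^ 2 := by rw [hs2]; ring
      _ ≤ 4 * ε ^ 4 * s ^ 2 := by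
        have : 0 ≤ ε ^ 4 * s ^ 2 := by positivity
        linarith
      _ = (2 * ε ^ 2 * s) ^ 2 := by ring
  have hsh : s ≤ 2 * ε ^ 2 * h := by
    refine le_of_sq_le_sq ?_ (by positivity)
    calc s ^ 2 = T * h := hs2
      _ ≤ 2 * ε ^ 4 * h * h := mul_le_mul_of_nonneg_right hTh hhpos.le
      _ ≤ 4 * ε ^ 4 * h ^ 2 := by
        have : 0 ≤ ε ^ 4 * h ^ 2 := by positivity
        linarith
      _ = (2 * ε ^ 2 * h) ^ 2 := by ring
  have hMs : M ≤ s / ε := by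
    have h1 : ε * M ≤ 4 * ε ^ 2 * s := by linarith
    have h2 : ε ^ 2 ≤ (1 / 16) ^ 2 := pow_le_pow_left₀ hε0.le hε1.le 2
    have h3 : 4 * ε ^ 2 * s ≤ 1 * s := mul_le_mul_of_nonneg_right (by linarith) hs0.le
    rw [le_div_iff₀ hε0]
    linarith
  -- the upper bound
  have hupper : ∃ t : ℕ, (t : ℝ) ≤ h + 3 / ε * s ∧ X.worstDist π t ≤ 4 * ε := by
    have hpos : 0 ≤ h + 3 / ε * s := by positivity
    refine ⟨⌊h + 3 / ε * s⌋₊, Nat.floor_le hpos, ?_⟩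
    have ht : h + 3 / ε * s < ⌊h + 3 / ε * s⌋₊ + 1 := Nat.lt_floor_add_one _
    set t := ⌊h + 3 / ε * s⌋₊
    have h3 : 3 / ε * s = 3 * (s / ε) := by ring
    have hsε : 0 < s / ε := div_pos hs0 hε0
    have htail : ∀ p E : ℝ, 0 ≤ p → E ≤ H → (E ≤ t + 1 → ε * (p * (t + 1 - E) ^ 2) ≤ T * E) →
        p ≤ ε := by
      intro p E hp hE hcheb
      have h4 : 2 * (s / ε) ≤ t + 1 - E := by linarith
      have h5 := hcheb (by linarith)
      have h6 : (2 * (s / ε)) ^ 2 ≤ (t + 1 - E) ^ 2 := pow_le_pow_left₀ (by positivity) h4 2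
      have h7 : ε * (p * (2 * (s / ε)) ^ 2) ≤ T * (2 * h) :=
        (mul_le_mul_of_nonneg_left (mul_le_mul_of_nonneg_left h6 hp) hε0.le).trans
          (h5.trans (mul_le_mul_of_nonneg_left (hE.trans hHh) hTpos.le))
      have h8 : ε * (p * (2 * (s / ε)) ^ 2) = 4 * s ^ 2 * (p / ε) := by
        field_simp
        ring
      rw [h8, show T * (2 * h) = 4 * s ^ 2 * (1 / 2) by rw [hs2]; ring] at h7
      have h9 := le_of_mul_le_mul_left h7 (by positivity)
      rw [div_le_iff₀ hε0] at h9
      linarith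
    have h4 := htail _ H (X.surv_nonneg b t 0) le_rfl (hchebL t)
    have h5 := htail _ H' (X.surv_nonneg a t _) hH'H (hchebR t)
    linarith [hdist t]
  obtain ⟨t₁, ht₁, hd₁⟩ := hupper
  have hU : (X.tmix π (4 * ε) : ℝ) ≤ h + 3 / ε * s := by
    have : (X.tmix π (4 * ε) : ℝ) ≤ t₁ := by exact_mod_cast X.tmix_le hd₁
    linarith
  -- the lower bound
  have hL : h - 2 / ε * s ≤ (X.tmix π (1 - 2 * ε) : ℝ) := by
    have hd : X.worstDist π (X.tmix π (1 - 2 * ε)) ≤ 1 - 2 * ε :=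
      X.worstDist_tmix_le (t := t₁) (by linarith)
    set t := X.tmix π (1 - 2 * ε)
    by_contra! hlt
    have h1 := hπ.surv_le_worstDist a t
    have hp : ε ≤ 1 - X.surv a t 0 := by linarith
    have h2 : 2 / ε * s = 2 * (s / ε) := by ring
    have h3 : s / ε ≤ X.meanHit π a 0 - t := by linarith
    have hsε : 0 < s / ε := div_pos hs0 hε0
    have h4 := hπ.one_sub_surv_mul_sq_le hirr a t (-X.meanHit π a 0) (by linarith) 0
      (Fin.zero_le a)
    simp only [Fin.val_zero, add_neg_cancel, zero_pow two_ne_zero, add_zero] at h4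
    have h5 : (s / ε) ^ 2 ≤ (-X.meanHit π a 0 + t) ^ 2 := by
      rw [← neg_sq (-X.meanHit π a 0 + t)]
      exact pow_le_pow_left₀ hsε.le (by linarith) 2
    have h6 : ε * (s / ε) ^ 2 ≤ X.varHit π a 0 :=
      (mul_le_mul hp h5 (sq_nonneg _) (by linarith)).trans h4
    have hmass : ∑ y ∈ Finset.Iio a, π y + ∑ y ∈ Finset.Ici a, π y = 1 := by
      rw [← hπ.sum_eq_one, ← Finset.sum_filter_add_sum_filter_not Finset.univ (fun y => y < a)]
      congr 1 <;> refine Finset.sum_congr ?_ fun _ _ => rfl <;> ext y <;> simp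
    have h7 := hπ.varHit_le hlazy hirr a
    have h8 : (1 / 2) * (ε * (s / ε) ^ 2) ≤ T * X.meanHit π a 0 :=
      (mul_le_mul (by linarith) h6 (by positivity) (by linarith)).trans h7
    have h9 : T * X.meanHit π a 0 ≤ s ^ 2 := by
      rw [hs2]
      exact mul_le_mul_of_nonneg_left (by linarith) hTpos.le
    have h10 : (1 / 2) * (ε * (s / ε) ^ 2) = s ^ 2 * (1 / (2 * ε)) := by
      field_simp
    rw [h10] at h8
    have h11 : s ^ 2 * (1 / (2 * ε)) ≤ s ^ 2 * 1 := by linarith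
    have h12 := le_of_mul_le_mul_left h11 (by positivity)
    rw [div_le_one (by positivity)] at h12
    linarith
  refine ⟨hL, hU, ?_⟩
  have hmono : (X.tmix π (1 - 2 * ε) : ℝ) ≤ X.tmix π (1 / 4) := by
    have h1 : X.worstDist π (X.tmix π (1 / 4)) ≤ 1 / 4 :=
      X.worstDist_tmix_le (t := t₁) (by linarith)
    exact_mod_cast X.tmix_le (h1.trans (by linarith))
  have h1 : 2 / ε * s ≤ h / 4 := by
    rw [div_mul_eq_mul_div, div_le_iff₀ hε0]
    have h2 : ε * (ε * h) ≤ 1 / 16 * (ε * h) :=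
      mul_le_mul_of_nonneg_right hε1.le (by positivity)
    nlinarith
  linarith

/-- Since the window is short compared with the location `h`, the latter can be replaced by
`t_mix(1/4)` in the bound on the window. -/
theorem window_le_of_location {ε T h u l q : ℝ} (hε : 0 < ε) (hT : 0 ≤ T) (hq0 : 0 ≤ q)
    (hl : h - (2 / ε) * √(T * h) ≤ l) (hu : u ≤ h + (3 / ε) * √(T * h)) (hq : h ≤ 4 / 3 * q) :
    u - l ≤ (6 / ε) * √(T * q) := by
  have h1 : √(T * h) ≤ 6 / 5 * √(T * q) := by
    rw [show (6 : ℝ) / 5 = √((6 / 5) ^ 2) by rw [Real.sqrt_sq]; norm_num,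
      ← Real.sqrt_mul (by positivity)]
    exact Real.sqrt_le_sqrt (by nlinarith [mul_nonneg hT hq0])
  have h2 : (5 / ε) * √(T * h) ≤ (5 / ε) * (6 / 5 * √(T * q)) :=
    mul_le_mul_of_nonneg_left h1 (by positivity)
  have h3 : (5 / ε) * (6 / 5 * √(T * q)) = (6 / ε) * √(T * q) := by ring
  have h4 : (5 / ε) * √(T * h) = (2 / ε) * √(T * h) + (3 / ε) * √(T * h) := by ring
  linarith

end BirthDeathChain

theorem quantile_mono {n : ℕ} {π : Fin (n + 1) → ℝ} (h : ∑ j, π j = 1) {δ δ' : ℝ} (hδ : δ ≤ δ')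
    (hδ' : δ' ≤ 1) : quantile π δ ≤ quantile π δ' :=
  (isLeast_quantile h (hδ.trans hδ')).2 (hδ.trans (isLeast_quantile h hδ').1)

theorem sum_Iio_quantile_le {n : ℕ} {π : Fin (n + 1) → ℝ} (h : ∑ j, π j = 1) {δ : ℝ}
    (hδ0 : 0 ≤ δ) (hδ1 : δ ≤ 1) : ∑ j ∈ Finset.Iio (quantile π δ), π j ≤ δ := by
  have hq := isLeast_quantile h hδ1
  generalize quantile π δ = q at hq
  induction q using Fin.cases with
  | zero =>
    have : Finset.Iio (0 : Fin (n + 1)) = ∅ := by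
      ext j
      simp
    rw [this, Finset.sum_empty]
    exact hδ0
  | succ i =>
    have : Finset.Iio i.succ = Finset.Iic i.castSucc := by
      ext j
      simp [Fin.lt_def, Fin.le_def]
    rw [this]
    by_contra! hlt
    exact absurd (hq.2 hlt.le) (not_le.2 Fin.castSucc_lt_succ)

theorem le_sum_Ici_quantile {n : ℕ} {π : Fin (n + 1) → ℝ} (h : ∑ j, π j = 1) {δ : ℝ}
    (hδ0 : 0 ≤ δ) (hδ1 : δ ≤ 1) : 1 - δ ≤ ∑ j ∈ Finset.Ici (quantile π δ), π j := by
  have h1 := sum_Iio_quantile_le h hδ0 hδ1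
  have h2 := Finset.sum_add_sum_compl (Finset.Iio (quantile π δ)) π
  have h3 : (Finset.Iio (quantile π δ))ᶜ = Finset.Ici (quantile π δ) := by
    ext j
    simp
  rw [h3] at h2
  linarith

theorem sum_Ioi_quantile_le {n : ℕ} {π : Fin (n + 1) → ℝ} (h : ∑ j, π j = 1) {δ : ℝ}
    (hδ1 : δ ≤ 1) : ∑ j ∈ Finset.Ioi (quantile π δ), π j ≤ 1 - δ := by
  have h1 := (isLeast_quantile h hδ1).1
  have h2 := Finset.sum_add_sum_compl (Finset.Iic (quantile π δ)) π
  have h3 : (Finset.Iic (quantile π δ))ᶜ = Finset.Ioi (quantile π δ) := by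
    ext j
    simp
  rw [h3] at h2
  have h4 : δ ≤ ∑ j ∈ Finset.Iic (quantile π δ), π j := h1
  linarith

end

theorem theorem2p2 {n : ℕ} (X : BirthDeathChain n) (hlazy : X.IsLazy) (hirr : X.IsIrreducible)
    (π : Fin (n + 1) → ℝ) (hπ : X.IsStationary π)
    (ε : ℝ) (hε0 : 0 < ε) (hε1 : ε < 1 / 16)
    (hrel : X.trel < ε ^ 5 * (X.tmix π (1 / 4) : ℝ)) :
    -- the bound on the cutoff window
    (X.tmix π (4 * ε) : ℝ) - (X.tmix π (1 - 2 * ε) : ℝ)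
        ≤ (6 / ε) * √(X.trel * (X.tmix π (1 / 4) : ℝ)) ∧
    -- the location of the cutoff, in the case `𝔼_0 τ_{Q(1-ε)} ≥ 𝔼_n τ_{Q(ε)}`
    (X.expHit (Fin.last n) (quantile π ε) ≤ X.expHit 0 (quantile π (1 - ε)) →
      X.expHit 0 (quantile π (1 / 2)) ≠ ∞ ∧
      (X.expHit 0 (quantile π (1 / 2))).toReal
          - (2 / ε) * √(X.trel * (X.expHit 0 (quantile π (1 / 2))).toReal)
        ≤ (X.tmix π (1 - 2 * ε) : ℝ) ∧
      (X.tmix π (4 * ε) : ℝ)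
        ≤ (X.expHit 0 (quantile π (1 / 2))).toReal
          + (3 / ε) * √(X.trel * (X.expHit 0 (quantile π (1 / 2))).toReal)) ∧
    -- the location of the cutoff, in the mirror case
    (X.expHit 0 (quantile π (1 - ε)) ≤ X.expHit (Fin.last n) (quantile π ε) →
      X.expHit (Fin.last n) (quantile π (1 / 2)) ≠ ∞ ∧
      (X.expHit (Fin.last n) (quantile π (1 / 2))).toReal
          - (2 / ε) * √(X.trel * (X.expHit (Fin.last n) (quantile π (1 / 2))).toReal)
        ≤ (X.tmix π (1 - 2 * ε) : ℝ) ∧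
      (X.tmix π (4 * ε) : ℝ)
        ≤ (X.expHit (Fin.last n) (quantile π (1 / 2))).toReal
          + (3 / ε) * √(X.trel * (X.expHit (Fin.last n) (quantile π (1 / 2))).toReal)) := by
  have h1 := hπ.sum_eq_one
  have ham : quantile π ε ≤ quantile π (1 / 2) := quantile_mono h1 (by linarith) (by norm_num)
  have hmb : quantile π (1 / 2) ≤ quantile π (1 - ε) :=
    quantile_mono h1 (by linarith) (by linarith)
  have ha : ε ≤ ∑ y ∈ Finset.Iic (quantile π ε), π y := (isLeast_quantile h1 (by linarith)).1
  have ha' := sum_Iio_quantile_le h1 hε0.le (by linarith)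
  have hb := le_sum_Ici_quantile h1 (δ := 1 - ε) (by linarith) (by linarith)
  have hb' := sum_Ioi_quantile_le h1 (δ := 1 - ε) (by linarith)
  rw [sub_sub_cancel] at hb hb'
  have hleft := hπ.cutoff_location hlazy hirr ham hmb hε0 hε1 ha ha' hb hb' hrel
  have hright := hπ.mirror.cutoff_location hlazy.mirror hirr.mirror
    (a := (quantile π (1 - ε)).rev) (m := (quantile π (1 / 2)).rev) (b := (quantile π ε).rev)
    (Fin.rev_le_rev.2 hmb) (Fin.rev_le_rev.2 ham) hε0 hε1
    (hb.trans_eq (BirthDeathChain.sum_rev_eq π fun y => by simp [Fin.le_rev_iff]).symm)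
    ((BirthDeathChain.sum_rev_eq π fun y => by simp [Fin.lt_rev_iff]).trans_le hb')
    (ha.trans_eq (BirthDeathChain.sum_rev_eq π fun y => by simp [Fin.rev_le_iff]).symm)
    ((BirthDeathChain.sum_rev_eq π fun y => by simp [Fin.rev_lt_iff]).trans_le ha')
    (by rwa [BirthDeathChain.mirror_trel, BirthDeathChain.mirror_tmix])
  simp only [BirthDeathChain.mirror_expHit, BirthDeathChain.mirror_trel,
    BirthDeathChain.mirror_tmix, Fin.rev_rev, Fin.rev_last, Fin.rev_zero] at hright
  have hwindow : ∀ h : ℝ, _ → _ → _ → _ := fun h =>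
    BirthDeathChain.window_le_of_location (h := h) (u := (X.tmix π (4 * ε) : ℝ))
      (l := (X.tmix π (1 - 2 * ε) : ℝ)) (q := (X.tmix π (1 / 4) : ℝ)) hε0
      (X.trel_pos hlazy).le (Nat.cast_nonneg _)
  refine ⟨?_, fun hle => ?_, fun hle => ?_⟩
  · rcases le_total (X.expHit (Fin.last n) (quantile π ε)) (X.expHit 0 (quantile π (1 - ε)))
      with hle | hle
    · obtain ⟨-, hl, hu, hq⟩ := hleft hle
      exact hwindow _ hl hu hq
    · obtain ⟨-, hl, hu, hq⟩ := hright hle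
      exact hwindow _ hl hu hq
  · obtain ⟨htop, hl, hu, -⟩ := hleft hle
    exact ⟨htop, hl, hu⟩
  · obtain ⟨htop, hl, hu, -⟩ := hright hle
    exact ⟨htop, hl, hu⟩
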